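/- Let $\mathbb K,\mathbb F\in\{\mathbb R,\mathbb C\}$. Let $\mathcal A_0$ be the set of even test functions $\varphi\in\mathcal D(\mathbb R)$ with values in $\mathbb F$ that are constant near $0$ and satisfy $\int_0^\infty\varphi=\tfrac12$; for $q\in\mathbb N$ let $\mathcal A_q$ be the set of $\varphi\in\mathcal A_0$ with $\int_0^\infty x^{j/m}\varphi(x)\,dx=0$ for all integers $1\le j,m\le q$. Put $\varphi_\varepsilon(x)=\varepsilon^{-1}\varphi(x/\varepsilon)$ and let $i(\varphi)>0$ be the diameter of the support of $\varphi$. Let $\Gamma$ be the set of strictly increasing sequences $\gamma:\mathbb N\to[0,\infty)$ with $\gamma(q)\to\infty$. A net $(v_\varphi)_{\varphi\in\mathcal A_0}$ of nonnegative numbers is *moderate* if there is $N\in\mathbb N$ such that for every $\varphi\in\mathcal A_N$ there are $c>0$, $\eta\in(0,1]$ with $v_{\varphi_\varepsilon}\le c\,\varepsilon^{-N}$ for $0<\varepsilon<\eta$; it is *negligible* if there are $N\in\mathbb N$, $\gamma\in\Gamma$ such that for all $q\ge N$ and $\varphi\in\mathcal A_q$ there are $c>0$, $\eta\in(0,1]$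 with $v_{\varphi_\varepsilon}\le c\,\varepsilon^{\gamma(q)-N}$ for $0<\varepsilon<\eta$. *Generalized numbers.* For $F\in\{\mathbb R,\mathbb C\}$ let $\overline F$ be the ring of nets $(a_\varphi)$ in $F$ with $(|a_\varphi|)$ moderate, modulo the ideal of those with $(|a_\varphi|)$ negligible; regard $\overline{\mathbb R}\subseteq\overline{\mathbb K}$. For $r\in\mathbb R$ let $\dot\alpha_r$ be the class of $\varphi\mapsto i(\varphi)^r$, and for $s>0$ let $\dot\beta_s=\dot\alpha_{-\log s}$, which is invertible. Write $x\approx0$ if for some (equivalently, every) representative $(x_\varphi)$ of $x$ there is $p$ with $\lim_{\varepsilon\downarrow0}x_{\varphi_\varepsilon}=0$ for all $\varphi\in\mathcal A_p$, and put $V(x)=\sup\{r\in\mathbb R:\dot\alpha_{-r}x\approx0\}$, $\|x\|=e^{-V(x)}$. The sharp topology on $\overline F$ is that of the ultrametric $\|x-y\|$; $\overline{\mathbb R}^n$ has the product topology and $\|x\|=\max_i\|x_i\|$. *Generalized functions.* For $\Omega\subseteq\mathbb R^n$ open, $\mathcal G(\Omega)$ is the ring of nets $(u_\varphi)_{\varphi\in\mathcal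 A_0}$ in $C^\infty(\Omega;\mathbb K)$ such that $(\sup_K|\partial^\alpha u_\varphi|)_\varphi$ is moderate for all compact $K\subseteq\Omega$ and all $\alpha\in\mathbb N^n$, modulo the ideal of those for which all these nets are negligible. It is a $\overline{\mathbb K}$-algebra via constant functions, and $\partial/\partial x_i$ acts on representatives. Its sharp topology is that of the ultra-pseudometrics $\|f-g\|_{K,l}=e^{-V_{K,l}(f-g)}$ ($K\subseteq\Omega$ compact, $l\in\mathbb N$), where $V_{K,l}(f)$ is the supremum of the $r\in\mathbb R$ for which there is $p$ such that $i(\varphi_\varepsilon)^{-r}\sup_K|\partial^\alpha u_{\varphi_\varepsilon}|\to0$ as $\varepsilon\downarrow0$ for all $\varphi\in\mathcal A_p$, $|\alpha|\le l$, with $(u_\varphi)$ a representative of $f$. *Points and pointvalues.* $\widetilde\Omega_c\subseteq\overline{\mathbb R}^n$ is the set of points having a representative $(x_\varphi)$ with $x_\varphi\in\Omega$ for all $\varphi$ for which there are a compact $K\subseteq\Omega$ and $p\in\mathbb N$ such that, for each $\varphi\in\mathcal A_p$, $x_{\varphi_\varepsilon}\in K$ for all small $\varepsilon>0$. For $f\in\mathcal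 G(\Omega)$ with representative $(u_\varphi)$ and $\tilde x\in\widetilde\Omega_c$ with such a representative $(x_\varphi)$, $f(\tilde x)\in\overline{\mathbb K}$ denotes the (well-defined) class of $(u_\varphi(x_\varphi))$. *Calculus.* Let $U\subseteq\overline{\mathbb R}^n$ be open, $g:U\to\overline{\mathbb K}$, $x_0\in U$. Then $g$ is differentiable at $x_0$ with derivative $a\in\overline{\mathbb K}^n$ if $\lim_{x\to x_0}\bigl(g(x)-g(x_0)-\sum_ia_i(x_i-x_{0,i})\bigr)/\dot\beta_{\|x-x_0\|}=0$, and $\frac{\partial g}{\partial x_i}(x_0)=b\in\overline{\mathbb K}$ if $\lim_{h\to0}\bigl(g(x_0+he_i)-g(x_0)-bh\bigr)/\dot\beta_{\|h\|}=0$ ($h\in\overline{\mathbb R}$, $h\neq0$). $\mathcal C^1(U;\overline{\mathbb K})$ is the set of continuous $g:U\to\overline{\mathbb K}$ all of whose partial derivatives exist on $U$ and are continuous. **Theorem (Embedding Theorem).** Let $\Omega\subseteq\mathbb R^n$ be open. Then $\widetilde\Omega_c$ is open in $\overline{\mathbb R}^n$, $\mathcal C^1(\widetilde\Omega_c;\overline{\mathbb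 K})$ is a $\overline{\mathbb K}$-algebra under the pointwise operations, and $\kappa(f)(\tilde x)=f(\tilde x)$ defines an injective homomorphism of $\overline{\mathbb K}$-algebras $$\kappa:\mathcal G(\Omega)\to\mathcal C^1(\widetilde\Omega_c;\overline{\mathbb K}).$$ Moreover, $\kappa$ is continuous from the sharp topology on $\mathcal G(\Omega)$ to the topology of pointwise convergence, every $\kappa(f)$ is differentiable at every $\tilde x\in\widetilde\Omega_c$ with derivative $\bigl(\kappa(\partial f/\partial x_1)(\tilde x),\dots,\kappa(\partial f/\partial x_n)(\tilde x)\bigr)$, and $$\kappa\Bigl(\frac{\partial f}{\partial x_i}\Bigr)=\frac{\partial(\kappa(f))}{\partial x_i}\qquad\text{for all } f\in\mathcal G(\Omega),\ 1\le i\le n.$$ -/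

import Mathlib

open scoped Topology ContDiff

noncomputable section

namespace Colombeau

/-! ### The index set: mollifiers -/

/-- The set `𝒜₀(𝔽)`: even test functions `φ ∈ 𝒟(ℝ)` with values in `𝔽` (`= ℝ` or `ℂ`) that are
constant near the origin and satisfy `∫₀^∞ φ = 1/2`. -/
structure TestFn (𝔽 : Type*) [RCLike 𝔽] where
  toFun : ℝ → 𝔽
  smooth : ContDiff ℝ ∞ toFun
  compact : HasCompactSupport toFun
  even : ∀ x, toFun (-x) = toFun x
  const_near_zero : ∃ c : 𝔽, ∀ᶠ x in 𝓝 (0 : ℝ), toFun x = c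
  integral_eq : ∫ x in Set.Ioi (0 : ℝ), toFun x = 1 / 2

/-- The sets `𝒜_q(𝔽)`: those `φ ∈ 𝒜₀(𝔽)` with `∫₀^∞ x^{j/m} φ(x) dx = 0` for `1 ≤ j, m ≤ q`. -/
def A (𝔽 : Type*) [RCLike 𝔽] (q : ℕ) : Set (TestFn 𝔽) :=
  {φ | ∀ j m : ℕ, 1 ≤ j → j ≤ q → 1 ≤ m → m ≤ q →
    ∫ x in Set.Ioi (0 : ℝ), (x ^ ((j : ℝ) / (m : ℝ)) : ℝ) • φ.toFun x = 0}

theorem A_anti (𝔽 : Type*) [RCLike 𝔽] {p q : ℕ} (h : p ≤ q) : A 𝔽 q ⊆ A 𝔽 p :=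
  fun _ hφ j m hj hjp hm hmp => hφ j m hj (hjp.trans h) hm (hmp.trans h)

/-- `φ_ε(x) = ε⁻¹ φ(x / ε)` for `ε > 0` (and, as a dummy value never used, `φ` for `ε ≤ 0`). -/
def TestFn.scale {𝔽 : Type*} [RCLike 𝔽] (φ : TestFn 𝔽) (ε : ℝ) : TestFn 𝔽 :=
  if h : 0 < ε then
    { toFun := fun x => ε⁻¹ • φ.toFun (x / ε)
      smooth := (φ.smooth.comp (contDiff_id.div_const ε)).const_smul ε⁻¹
      compact := by
        have h1 : HasCompactSupport (fun x : ℝ => φ.toFun (x / ε)) := by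
          have := φ.compact.comp_homeomorph (Homeomorph.mulRight₀ ε⁻¹ (inv_ne_zero h.ne'))
          simpa [Function.comp_def, div_eq_mul_inv] using this
        exact h1.smul_left (f := fun _ : ℝ => ε⁻¹)
      even := fun x => by rw [neg_div, φ.even]
      const_near_zero := by
        obtain ⟨c, hc⟩ := φ.const_near_zero
        refine ⟨ε⁻¹ • c, ?_⟩
        have ht : Filter.Tendsto (fun x : ℝ => x / ε) (𝓝 0) (𝓝 0) := by
          have : Continuous (fun x : ℝ => x / ε) := continuous_id.div_const ε
          simpa using this.tendsto 0
        filter_upwards [ht.eventually hc] with x hx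
        rw [hx]
      integral_eq := by
        rw [MeasureTheory.integral_smul]
        have := MeasureTheory.integral_comp_mul_right_Ioi φ.toFun 0 (inv_pos.2 h)
        simp only [zero_mul, inv_inv] at this
        simp only [div_eq_mul_inv]
        rw [this, φ.integral_eq, smul_smul, inv_mul_cancel₀ h.ne', one_smul, one_div, one_mul] }
  else φ

theorem TestFn.scale_toFun {𝔽 : Type*} [RCLike 𝔽] (φ : TestFn 𝔽) {ε : ℝ} (h : 0 < ε) :
    (φ.scale ε).toFun = fun x => ε⁻¹ • φ.toFun (x / ε) := by
  simp [TestFn.scale, h]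

/-- `i(φ)`: the diameter of the support of `φ`. -/
def TestFn.i {𝔽 : Type*} [RCLike 𝔽] (φ : TestFn 𝔽) : ℝ := Metric.diam (tsupport φ.toFun)

theorem TestFn.i_pos {𝔽 : Type*} [RCLike 𝔽] (φ : TestFn 𝔽) : 0 < φ.i := by
  have hne : ∃ x ∈ Set.Ioi (0 : ℝ), φ.toFun x ≠ 0 := by
    by_contra! hcon
    have h0 : ∫ x in Set.Ioi (0 : ℝ), φ.toFun x = 0 :=
      MeasureTheory.setIntegral_eq_zero_of_forall_eq_zero hcon
    have := φ.integral_eq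
    rw [h0] at this
    norm_num at this
  obtain ⟨x, hx, hφ⟩ := hne
  have hx' : (0 : ℝ) < x := hx
  have h1 : x ∈ tsupport φ.toFun := subset_tsupport _ hφ
  have h2 : -x ∈ tsupport φ.toFun := subset_tsupport _ (by simpa [φ.even] using hφ)
  have h3 := Metric.dist_le_diam_of_mem φ.compact.isCompact.isBounded h1 h2
  have h4 : dist x (-x) = 2 * x := by
    rw [Real.dist_eq, sub_neg_eq_add, abs_of_pos (by linarith)]; ring
  have h5 : dist x (-x) ≤ φ.i := h3
  linarith

open scoped Pointwise in
theorem TestFn.i_scale {𝔽 : Type*} [RCLike 𝔽] (φ : TestFn 𝔽) {ε : ℝ} (h : 0 < ε) :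
    (φ.scale ε).i = ε * φ.i := by
  have h1 : tsupport (φ.scale ε).toFun = ε • tsupport φ.toFun := by
    have h2 : Function.support (φ.scale ε).toFun = ε • Function.support φ.toFun := by
      ext x
      rw [TestFn.scale_toFun φ h, Set.mem_smul_set_iff_inv_smul_mem₀ h.ne']
      simp [h.ne', div_eq_mul_inv, mul_comm]
    rw [tsupport, h2, closure_smul₀' h.ne', tsupport]
  rw [TestFn.i, h1, diam_smul₀, Real.norm_of_nonneg h.le, TestFn.i]

/-- The set `Γ` of strictly increasing sequences of nonnegative reals that diverge to infinity. -/
def Gam : Set (ℕ → ℝ) :=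
  {γ | (∀ n, 0 ≤ γ n) ∧ StrictMono γ ∧ Filter.Tendsto γ Filter.atTop Filter.atTop}

theorem Gam_id : (fun n : ℕ => (n : ℝ)) ∈ Gam :=
  ⟨fun n => n.cast_nonneg, Nat.strictMono_cast, tendsto_natCast_atTop_atTop⟩

theorem Gam_min {γ δ : ℕ → ℝ} (hγ : γ ∈ Gam) (hδ : δ ∈ Gam) : (fun n => min (γ n) (δ n)) ∈ Gam := by
  refine ⟨fun n => le_min (hγ.1 n) (hδ.1 n), fun a b hab => min_lt_min (hγ.2.1 hab) (hδ.2.1 hab), ?_⟩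
  rw [Filter.tendsto_atTop]
  intro b
  filter_upwards [Filter.tendsto_atTop.1 hγ.2.2 b, Filter.tendsto_atTop.1 hδ.2.2 b] with n h1 h2
  exact le_min h1 h2

/-! ### Moderate and negligible nets

The two growth conditions for nets `v` of real functions, uniformly on a set `S`. They are applied
with `v` the absolute value of a net of numbers, or of the derivatives of a net of functions. -/

section Nets

variable {𝔽 : Type*} [RCLike 𝔽] {ι : Type*}

/-- `∃ N ∀ φ ∈ 𝒜_N ∃ c > 0 ∃ η ∈ ]0,1] ∀ ε ∈ ]0,η[ : sup_S v(φ_ε) ≤ c ε^{-N}`. -/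
def ModOn (S : Set ι) (v : TestFn 𝔽 → ι → ℝ) : Prop :=
  ∃ N : ℕ, ∀ φ ∈ A 𝔽 N, ∃ c > (0 : ℝ), ∃ η : ℝ, 0 < η ∧ η ≤ 1 ∧
    ∀ ε : ℝ, 0 < ε → ε < η → ∀ x ∈ S, v (φ.scale ε) x ≤ c * ε ^ (-(N : ℝ))

/-- `∃ N ∃ γ ∈ Γ ∀ q ≥ N ∀ φ ∈ 𝒜_q ∃ c > 0 ∃ η ∈ ]0,1] ∀ ε ∈ ]0,η[ :
sup_S v(φ_ε) ≤ c ε^{γ(q) - N}`. -/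
def NullOn (S : Set ι) (v : TestFn 𝔽 → ι → ℝ) : Prop :=
  ∃ N : ℕ, ∃ γ ∈ Gam, ∀ q : ℕ, N ≤ q → ∀ φ ∈ A 𝔽 q, ∃ c > (0 : ℝ), ∃ η : ℝ, 0 < η ∧ η ≤ 1 ∧
    ∀ ε : ℝ, 0 < ε → ε < η → ∀ x ∈ S, v (φ.scale ε) x ≤ c * ε ^ (γ q - (N : ℝ))

variable {S : Set ι} {v w : TestFn 𝔽 → ι → ℝ}

theorem ModOn.mono (hw : ModOn S w) (h : ∀ φ, ∀ x ∈ S, v φ x ≤ w φ x) : ModOn S v := by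
  obtain ⟨N, hN⟩ := hw
  refine ⟨N, fun φ hφ => ?_⟩
  obtain ⟨c, hc, η, h0, h1, H⟩ := hN φ hφ
  exact ⟨c, hc, η, h0, h1, fun ε e0 e1 x hx => (h _ x hx).trans (H ε e0 e1 x hx)⟩

theorem NullOn.mono (hw : NullOn S w) (h : ∀ φ, ∀ x ∈ S, v φ x ≤ w φ x) : NullOn S v := by
  obtain ⟨N, γ, hγ, hN⟩ := hw
  refine ⟨N, γ, hγ, fun q hq φ hφ => ?_⟩
  obtain ⟨c, hc, η, h0, h1, H⟩ := hN q hq φ hφ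
  exact ⟨c, hc, η, h0, h1, fun ε e0 e1 x hx => (h _ x hx).trans (H ε e0 e1 x hx)⟩

theorem ModOn.of_bdd (M : TestFn 𝔽 → ℝ) (N : ℕ)
    (h : ∀ φ ε, 0 < ε → ε < 1 → ∀ x ∈ S, v (φ.scale ε) x ≤ M φ * ε ^ (-(N : ℝ))) : ModOn S v := by
  refine ⟨N, fun φ _ => ⟨max (M φ) 1, by positivity, 1, one_pos, le_rfl, fun ε e0 e1 x hx => ?_⟩⟩
  refine (h φ ε e0 e1 x hx).trans ?_
  gcongr
  exact le_max_left _ _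

theorem ModOn.const (C : ℝ) : ModOn (𝔽 := 𝔽) S (fun _ _ => C) :=
  ModOn.of_bdd (fun _ => C) 0 (by simp)

theorem NullOn.zero : NullOn (𝔽 := 𝔽) S (fun _ _ => 0) :=
  ⟨0, _, Gam_id, fun q _ φ _ => ⟨1, one_pos, 1, one_pos, le_rfl, fun ε e0 _ x _ => by positivity⟩⟩

theorem ModOn.add (hv : ModOn S v) (hw : ModOn S w) : ModOn S (fun φ x => v φ x + w φ x) := by
  obtain ⟨N, hN⟩ := hv
  obtain ⟨M, hM⟩ := hw
  refine ⟨N + M, fun φ hφ => ?_⟩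
  obtain ⟨c, hc, η, h0, h1, H⟩ := hN φ (A_anti 𝔽 (Nat.le_add_right _ _) hφ)
  obtain ⟨d, hd, θ, k0, k1, K⟩ := hM φ (A_anti 𝔽 (Nat.le_add_left _ _) hφ)
  refine ⟨c + d, by positivity, min η θ, lt_min h0 k0, (min_le_left _ _).trans h1,
    fun ε e0 e1 x hx => ?_⟩
  have e2 : ε ≤ 1 := (e1.trans_le ((min_le_left _ _).trans h1)).le
  have A1 := H ε e0 (e1.trans_le (min_le_left _ _)) x hx
  have A2 := K ε e0 (e1.trans_le (min_le_right _ _)) x hx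
  have B1 : ε ^ (-(N : ℝ)) ≤ ε ^ (-((N + M : ℕ) : ℝ)) :=
    Real.rpow_le_rpow_of_exponent_ge e0 e2 (by push_cast; linarith [(Nat.cast_nonneg M : (0:ℝ) ≤ M)])
  have B2 : ε ^ (-(M : ℝ)) ≤ ε ^ (-((N + M : ℕ) : ℝ)) :=
    Real.rpow_le_rpow_of_exponent_ge e0 e2 (by push_cast; linarith [(Nat.cast_nonneg N : (0:ℝ) ≤ N)])
  have := mul_le_mul_of_nonneg_left B1 hc.le
  have := mul_le_mul_of_nonneg_left B2 hd.le
  linarith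

theorem NullOn.add (hv : NullOn S v) (hw : NullOn S w) : NullOn S (fun φ x => v φ x + w φ x) := by
  obtain ⟨N, γ, hγ, hN⟩ := hv
  obtain ⟨M, δ, hδ, hM⟩ := hw
  refine ⟨N + M, _, Gam_min hγ hδ, fun q hq φ hφ => ?_⟩
  obtain ⟨c, hc, η, h0, h1, H⟩ := hN q (by omega) φ hφ
  obtain ⟨d, hd, θ, k0, k1, K⟩ := hM q (by omega) φ hφ
  refine ⟨c + d, by positivity, min η θ, lt_min h0 k0, (min_le_left _ _).trans h1,
    fun ε e0 e1 x hx => ?_⟩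
  have e2 : ε ≤ 1 := (e1.trans_le ((min_le_left _ _).trans h1)).le
  have A1 := H ε e0 (e1.trans_le (min_le_left _ _)) x hx
  have A2 := K ε e0 (e1.trans_le (min_le_right _ _)) x hx
  have B1 : ε ^ (γ q - (N : ℝ)) ≤ ε ^ (min (γ q) (δ q) - ((N + M : ℕ) : ℝ)) :=
    Real.rpow_le_rpow_of_exponent_ge e0 e2 (by
      push_cast; linarith [(Nat.cast_nonneg M : (0:ℝ) ≤ M), min_le_left (γ q) (δ q)])
  have B2 : ε ^ (δ q - (M : ℝ)) ≤ ε ^ (min (γ q) (δ q) - ((N + M : ℕ) : ℝ)) :=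
    Real.rpow_le_rpow_of_exponent_ge e0 e2 (by
      push_cast; linarith [(Nat.cast_nonneg N : (0:ℝ) ≤ N), min_le_right (γ q) (δ q)])
  have := mul_le_mul_of_nonneg_left B1 hc.le
  have := mul_le_mul_of_nonneg_left B2 hd.le
  linarith

theorem ModOn.mul (hv : ModOn S v) (hw : ModOn S w)
    (hw0 : ∀ φ, ∀ x ∈ S, 0 ≤ w φ x) : ModOn S (fun φ x => v φ x * w φ x) := by
  obtain ⟨N, hN⟩ := hv
  obtain ⟨M, hM⟩ := hw
  refine ⟨N + M, fun φ hφ => ?_⟩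
  obtain ⟨c, hc, η, h0, h1, H⟩ := hN φ (A_anti 𝔽 (Nat.le_add_right _ _) hφ)
  obtain ⟨d, hd, θ, k0, k1, K⟩ := hM φ (A_anti 𝔽 (Nat.le_add_left _ _) hφ)
  refine ⟨c * d, by positivity, min η θ, lt_min h0 k0, (min_le_left _ _).trans h1,
    fun ε e0 e1 x hx => ?_⟩
  have A1 := H ε e0 (e1.trans_le (min_le_left _ _)) x hx
  have A2 := K ε e0 (e1.trans_le (min_le_right _ _)) x hx
  calc _ ≤ (c * ε ^ (-(N : ℝ))) * (d * ε ^ (-(M : ℝ))) :=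
        mul_le_mul A1 A2 (hw0 _ x hx) (by positivity)
    _ = c * d * ε ^ (-((N + M : ℕ) : ℝ)) := by
        rw [show (-((N + M : ℕ) : ℝ)) = -(N : ℝ) + -(M : ℝ) by push_cast; ring, Real.rpow_add e0]
        ring

theorem NullOn.mul (hv : NullOn S v) (hw : ModOn S w)
    (hw0 : ∀ φ, ∀ x ∈ S, 0 ≤ w φ x) : NullOn S (fun φ x => v φ x * w φ x) := by
  obtain ⟨N, γ, hγ, hN⟩ := hv
  obtain ⟨M, hM⟩ := hw
  refine ⟨N + M, γ, hγ, fun q hq φ hφ => ?_⟩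
  obtain ⟨c, hc, η, h0, h1, H⟩ := hN q (by omega) φ hφ
  obtain ⟨d, hd, θ, k0, k1, K⟩ := hM φ (A_anti 𝔽 (by omega) hφ)
  refine ⟨c * d, by positivity, min η θ, lt_min h0 k0, (min_le_left _ _).trans h1,
    fun ε e0 e1 x hx => ?_⟩
  have A1 := H ε e0 (e1.trans_le (min_le_left _ _)) x hx
  have A2 := K ε e0 (e1.trans_le (min_le_right _ _)) x hx
  calc _ ≤ (c * ε ^ (γ q - (N : ℝ))) * (d * ε ^ (-(M : ℝ))) :=
        mul_le_mul A1 A2 (hw0 _ x hx) (by positivity)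
    _ = c * d * ε ^ (γ q - ((N + M : ℕ) : ℝ)) := by
        rw [show (γ q - ((N + M : ℕ) : ℝ)) = (γ q - (N : ℝ)) + -(M : ℝ) by push_cast; ring,
          Real.rpow_add e0]
        ring

theorem ModOn.sum {κ : Type*} (s : Finset κ) (f : κ → TestFn 𝔽 → ι → ℝ)
    (h : ∀ k ∈ s, ModOn S (f k)) : ModOn S (fun φ x => ∑ k ∈ s, f k φ x) := by
  classical
  induction s using Finset.induction_on with
  | empty => simpa using ModOn.const 0
  | insert a s ha ih =>
    simp only [Finset.sum_insert ha]
    exact (h a (by simp)).add (ih fun k hk => h k (by simp [hk]))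

theorem NullOn.sum {κ : Type*} (s : Finset κ) (f : κ → TestFn 𝔽 → ι → ℝ)
    (h : ∀ k ∈ s, NullOn S (f k)) : NullOn S (fun φ x => ∑ k ∈ s, f k φ x) := by
  classical
  induction s using Finset.induction_on with
  | empty => simpa using NullOn.zero
  | insert a s ha ih =>
    simp only [Finset.sum_insert ha]
    exact (h a (by simp)).add (ih fun k hk => h k (by simp [hk]))

end Nets

/-! ### Generalized numbers -/

section Numbers

variable (𝔽 : Type*) [RCLike 𝔽] (F : Type*) [RCLike F]

/-- The ring of moderate nets `𝒜₀ → F` (`F = ℝ` or `ℂ`). -/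
def ModNum : Subring (TestFn 𝔽 → F) where
  carrier := {a | ModOn (Set.univ : Set Unit) (fun φ _ => ‖a φ‖)}
  mul_mem' := fun {a b} ha hb =>
    (ModOn.mul (v := fun φ (_ : Unit) => ‖a φ‖) (w := fun φ _ => ‖b φ‖) ha hb (fun _ _ _ => norm_nonneg _)).mono
      (fun φ _ _ => norm_mul_le (a φ) (b φ))
  one_mem' := by simpa using ModOn.const 1
  add_mem' := fun {a b} ha hb => 
    (ModOn.add (v := fun φ (_ : Unit) => ‖a φ‖) (w := fun φ _ => ‖b φ‖) ha hb).mono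
      (fun φ _ _ => norm_add_le (a φ) (b φ))
  zero_mem' := by simpa using ModOn.const 0
  neg_mem' := fun {a} ha => by simpa using ha

/-- The ideal of negligible nets. -/
def NullNum : Ideal (ModNum 𝔽 F) where
  carrier := {a | NullOn (Set.univ : Set Unit) (fun φ _ => ‖a.1 φ‖)}
  add_mem' := fun {a b} ha hb =>
    (NullOn.add (v := fun φ (_ : Unit) => ‖a.1 φ‖) (w := fun φ _ => ‖b.1 φ‖) ha hb).mono (fun φ _ _ => norm_add_le (a.1 φ) (b.1 φ))
  zero_mem' := by simpa using NullOn.zero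
  smul_mem' := fun c a ha =>
    (NullOn.mul (v := fun φ (_ : Unit) => ‖a.1 φ‖) (w := fun φ _ => ‖c.1 φ‖) ha c.2 (fun _ _ _ => norm_nonneg _)).mono
      (fun φ _ _ => (norm_mul_le (c.1 φ) (a.1 φ)).trans_eq (mul_comm _ _))

/-- The ring of full generalized numbers with values in `F`: `ℝ̄` for `F = ℝ`, `ℂ̄` for `F = ℂ`.
The nets are indexed by `𝒜₀(𝔽)`. -/
def GenNum : Type _ := ModNum 𝔽 F ⧸ NullNum 𝔽 F

instance : CommRing (GenNum 𝔽 F) := inferInstanceAs (CommRing (ModNum 𝔽 F ⧸ NullNum 𝔽 F))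

variable {𝔽 F}

/-- The class of a moderate net. -/
def GenNum.mk : ModNum 𝔽 F →+* GenNum 𝔽 F := Ideal.Quotient.mk (NullNum 𝔽 F)

theorem GenNum.mk_surjective : Function.Surjective (GenNum.mk : ModNum 𝔽 F → GenNum 𝔽 F) :=
  Ideal.Quotient.mk_surjective

theorem GenNum.mk_eq_mk {a b : ModNum 𝔽 F} :
    GenNum.mk a = GenNum.mk b ↔ NullOn (Set.univ : Set Unit) (fun φ _ => ‖a.1 φ - b.1 φ‖) :=
  Ideal.Quotient.eq

/-- The inclusion `ℝ̄ → F̄`. -/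
def GenNum.ofReal : GenNum 𝔽 ℝ →+* GenNum 𝔽 F :=
  Ideal.quotientMap (I := NullNum 𝔽 ℝ) (NullNum 𝔽 F)
    (RingHom.codRestrict
      (((algebraMap ℝ F).compLeft (TestFn 𝔽)).comp (ModNum 𝔽 ℝ).subtype) (ModNum 𝔽 F)
      (fun a => by
        have h : ModOn (Set.univ : Set Unit) (fun φ _ => ‖algebraMap ℝ F (a.1 φ)‖) := by
          have h' : ModOn (Set.univ : Set Unit) (fun φ _ => ‖a.1 φ‖) := a.2
          simpa using h'
        exact h))
    (fun a ha => by
      have h : NullOn (Set.univ : Set Unit) (fun φ _ => ‖algebraMap ℝ F (a.1 φ)‖) := by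
        have h' : NullOn (Set.univ : Set Unit) (fun φ _ => ‖a.1 φ‖) := ha
        simpa using h'
      exact h)

theorem alpha_mem (r : ℝ) : (fun φ : TestFn 𝔽 => ((φ.i ^ r : ℝ) : F)) ∈ ModNum 𝔽 F := by
  change ModOn (Set.univ : Set Unit) (fun (φ : TestFn 𝔽) _ => ‖((φ.i ^ r : ℝ) : F)‖)
  refine ModOn.of_bdd (fun φ : TestFn 𝔽 => φ.i ^ r) ⌈-r⌉₊ fun φ ε e0 e1 x _ => ?_
  have hi := φ.i_pos
  rw [φ.i_scale e0, Real.mul_rpow e0.le hi.le, RCLike.norm_ofReal, abs_of_nonneg (by positivity),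
    mul_comm]
  gcongr ?_ * ?_
  exact Real.rpow_le_rpow_of_exponent_ge e0 e1.le (by linarith [Nat.le_ceil (-r)])

variable (𝔽 F) in
/-- The generalized number `α̇_r`, the class of `φ ↦ i(φ)^r`. -/
def alphaDot (r : ℝ) : GenNum 𝔽 F := GenNum.mk ⟨fun φ => ((φ.i ^ r : ℝ) : F), alpha_mem r⟩

theorem alphaDot_mul (r s : ℝ) : alphaDot 𝔽 F r * alphaDot 𝔽 F s = alphaDot 𝔽 F (r + s) := by
  rw [alphaDot, alphaDot, alphaDot, ← map_mul]
  congr 1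
  apply Subtype.ext
  funext φ
  change ((φ.i ^ r : ℝ) : F) * ((φ.i ^ s : ℝ) : F) = ((φ.i ^ (r + s) : ℝ) : F)
  rw [Real.rpow_add φ.i_pos, RCLike.ofReal_mul]

theorem alphaDot_zero : alphaDot 𝔽 F 0 = 1 := by
  rw [alphaDot, ← map_one GenNum.mk]
  congr 1
  apply Subtype.ext
  funext φ
  change ((φ.i ^ (0 : ℝ) : ℝ) : F) = 1
  simp

variable (𝔽 F) in
/-- The invertible generalized number `β̇_s = α̇_{-log s}`, `s > 0`. -/
def betaDot (s : ℝ) : (GenNum 𝔽 F)ˣ where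
  val := alphaDot 𝔽 F (-Real.log s)
  inv := alphaDot 𝔽 F (Real.log s)
  val_inv := by rw [alphaDot_mul, neg_add_cancel, alphaDot_zero]
  inv_val := by rw [alphaDot_mul, add_neg_cancel, alphaDot_zero]

/-- `x ≈ 0`: for some (equivalently, every) representative `v` of `x` there is `p` such that
`v(φ_ε) → 0` as `ε ↓ 0`, for all `φ ∈ 𝒜_p`. -/
def AssocZero (x : GenNum 𝔽 F) : Prop :=
  ∃ v : ModNum 𝔽 F, GenNum.mk v = x ∧ ∃ p : ℕ, ∀ φ ∈ A 𝔽 p,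
    Filter.Tendsto (fun ε : ℝ => v.1 (φ.scale ε)) (𝓝[>] 0) (𝓝 0)

/-- The valuation `V(x) = sup {r : α̇_{-r} x ≈ 0}`. -/
def val (x : GenNum 𝔽 F) : EReal :=
  sSup ((fun r : ℝ => (r : EReal)) '' {r : ℝ | AssocZero (alphaDot 𝔽 F (-r) * x)})

/-- The sharp norm `‖x‖ = e^{-V(x)}`. -/
def sharpNorm (x : GenNum 𝔽 F) : ℝ := (EReal.exp (-val x)).toReal

/-- The sharp topology on generalized numbers, generated by the open balls of the ultrametric
`D(x, y) = ‖x - y‖`. The powers `ℝ̄ⁿ` carry the product topology. -/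
instance : TopologicalSpace (GenNum 𝔽 F) :=
  TopologicalSpace.generateFrom
    {B | ∃ (a : GenNum 𝔽 F) (ρ : ℝ), 0 < ρ ∧ B = {x | sharpNorm (x - a) < ρ}}

/-- The sharp norm on `F̄ⁿ`, the maximum of the norms of the coordinates. -/
def sharpNormVec {n : ℕ} (x : Fin n → GenNum 𝔽 F) : ℝ := ⨆ i, sharpNorm (x i)

end Numbers

/-! ### Generalized functions

A function on the open set `Ω ⊆ ℝⁿ` is represented by a function on `ℝⁿ` whose values outside `Ω`
are irrelevant: only the values on `Ω` enter the definitions, and nets that vanish on `Ω` are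
negligible. The total derivative `iteratedFDeriv ℝ k` of order `k` collects all the partial
derivatives `∂^α` with `|α| = k`. -/

section Functions

variable (𝔽 : Type*) [RCLike 𝔽] (𝕂 : Type*) [RCLike 𝕂] {n : ℕ}
variable (Ω : TopologicalSpace.Opens (Fin n → ℝ))

theorem norm_iterated_add {f g : (Fin n → ℝ) → 𝕂} (hf : ContDiffOn ℝ ∞ f Ω)
    (hg : ContDiffOn ℝ ∞ g Ω) (k : ℕ) {x : Fin n → ℝ} (hx : x ∈ Ω) :
    ‖iteratedFDeriv ℝ k (f + g) x‖ ≤ ‖iteratedFDeriv ℝ k f x‖ + ‖iteratedFDeriv ℝ k g x‖ := by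
  have h1 : ContDiffAt ℝ k f x := (hf.contDiffAt (Ω.2.mem_nhds hx)).of_le (by exact_mod_cast le_top)
  have h2 : ContDiffAt ℝ k g x := (hg.contDiffAt (Ω.2.mem_nhds hx)).of_le (by exact_mod_cast le_top)
  rw [iteratedFDeriv_add_apply h1 h2]
  exact norm_add_le _ _

theorem norm_iterated_mul {f g : (Fin n → ℝ) → 𝕂} (hf : ContDiffOn ℝ ∞ f Ω)
    (hg : ContDiffOn ℝ ∞ g Ω) (k : ℕ) {x : Fin n → ℝ} (hx : x ∈ Ω) :
    ‖iteratedFDeriv ℝ k (f * g) x‖ ≤ ∑ i ∈ Finset.range (k + 1),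
      ‖iteratedFDeriv ℝ i f x‖ * ((k.choose i : ℝ) * ‖iteratedFDeriv ℝ (k - i) g x‖) := by
  have h := norm_iteratedFDerivWithin_mul_le hf hg Ω.2.uniqueDiffOn hx (n := k)
    (by exact_mod_cast le_top)
  have e : ∀ (j : ℕ) (g : (Fin n → ℝ) → 𝕂),
      iteratedFDerivWithin ℝ j g Ω x = iteratedFDeriv ℝ j g x :=
    fun j g => iteratedFDerivWithin_of_isOpen j Ω.2 hx
  simp only [e] at h
  refine h.trans_eq (Finset.sum_congr rfl fun i _ => ?_)
  ring

theorem norm_iterated_const (c : 𝕂) (k : ℕ) (x : Fin n → ℝ) :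
    ‖iteratedFDeriv ℝ k (fun _ : Fin n → ℝ => c) x‖ ≤ ‖c‖ := by
  rcases eq_or_ne k 0 with rfl | hk
  · simp
  · rw [iteratedFDeriv_const_of_ne hk]; simp

/-- The ring `ℰ_M(Ω)` of moderate nets of smooth functions: all derivatives are moderate, uniformly
on each compact subset of `Ω`. -/
def ModFun : Subring (TestFn 𝔽 → (Fin n → ℝ) → 𝕂) where
  carrier := {u | (∀ φ, ContDiffOn ℝ ∞ (u φ) Ω) ∧ ∀ K : Set (Fin n → ℝ), IsCompact K → K ⊆ Ω →
    ∀ k : ℕ, ModOn K (fun φ x => ‖iteratedFDeriv ℝ k (u φ) x‖)}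
  mul_mem' := fun {u v} hu hv => ⟨fun φ => (hu.1 φ).mul (hv.1 φ), fun K hK hKΩ k =>
    (ModOn.sum (Finset.range (k + 1)) _ (fun i _ =>
      ModOn.mul (hu.2 K hK hKΩ i) (ModOn.mul (ModOn.const (k.choose i : ℝ)) (hv.2 K hK hKΩ (k - i))
        (fun _ _ _ => by positivity))
        (fun _ _ _ => by positivity))).mono
      (fun φ x hx => norm_iterated_mul 𝕂 Ω (hu.1 φ) (hv.1 φ) k (hKΩ hx))⟩
  one_mem' := ⟨fun φ => contDiffOn_const, fun K _ _ k => (ModOn.const 1).mono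
    (fun φ x _ => by exact (norm_iterated_const 𝕂 (1 : 𝕂) k x).trans_eq norm_one)⟩
  add_mem' := fun {u v} hu hv => ⟨fun φ => (hu.1 φ).add (hv.1 φ), fun K hK hKΩ k =>
    (ModOn.add (hu.2 K hK hKΩ k) (hv.2 K hK hKΩ k)).mono
      (fun φ x hx => norm_iterated_add 𝕂 Ω (hu.1 φ) (hv.1 φ) k (hKΩ hx))⟩
  zero_mem' := ⟨fun φ => contDiffOn_const, fun K _ _ k => (ModOn.const 0).mono
    (fun φ x _ => by exact (norm_iterated_const 𝕂 (0 : 𝕂) k x).trans_eq norm_zero)⟩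
  neg_mem' := fun {u} hu => ⟨fun φ => (hu.1 φ).neg, fun K hK hKΩ k =>
    (hu.2 K hK hKΩ k).mono (fun φ x _ => by
      rw [Pi.neg_apply, iteratedFDeriv_neg, Pi.neg_apply, norm_neg])⟩

/-- The ideal `𝒩(Ω)` of negligible nets. -/
def NullFun : Ideal (ModFun 𝔽 𝕂 Ω) where
  carrier := {u | ∀ K : Set (Fin n → ℝ), IsCompact K → K ⊆ Ω →
    ∀ k : ℕ, NullOn K (fun φ x => ‖iteratedFDeriv ℝ k (u.1 φ) x‖)}
  add_mem' := fun {u v} hu hv K hK hKΩ k =>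
    (NullOn.add (hu K hK hKΩ k) (hv K hK hKΩ k)).mono
      (fun φ x hx => norm_iterated_add 𝕂 Ω (u.2.1 φ) (v.2.1 φ) k (hKΩ hx))
  zero_mem' := fun K _ _ k => NullOn.zero.mono
    (fun φ x _ => by exact (norm_iterated_const 𝕂 (0 : 𝕂) k x).trans_eq norm_zero)
  smul_mem' := fun c u hu K hK hKΩ k =>
    (NullOn.sum (Finset.range (k + 1)) _ (fun i _ =>
      NullOn.mul (hu K hK hKΩ i) (ModOn.mul (ModOn.const (k.choose i : ℝ))
        (c.2.2 K hK hKΩ (k - i)) (fun _ _ _ => by positivity))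
        (fun _ _ _ => by positivity))).mono
      (fun φ x hx => by
        have := norm_iterated_mul 𝕂 Ω (u.2.1 φ) (c.2.1 φ) k (hKΩ hx)
        rwa [mul_comm (u.1 φ)] at this)

/-- The algebra `𝒢(Ω) = ℰ_M(Ω) / 𝒩(Ω)` of full generalized functions with values in `𝕂`. -/
def GenFun : Type _ := ModFun 𝔽 𝕂 Ω ⧸ NullFun 𝔽 𝕂 Ω

instance : CommRing (GenFun 𝔽 𝕂 Ω) := inferInstanceAs (CommRing (ModFun 𝔽 𝕂 Ω ⧸ NullFun 𝔽 𝕂 Ω))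

/-- The class of a moderate net of functions. -/
def GenFun.mk : ModFun 𝔽 𝕂 Ω →+* GenFun 𝔽 𝕂 Ω := Ideal.Quotient.mk (NullFun 𝔽 𝕂 Ω)

/-- The embedding `𝕂̄ → 𝒢(Ω)` as constant functions. -/
def constHom : GenNum 𝔽 𝕂 →+* GenFun 𝔽 𝕂 Ω :=
  Ideal.quotientMap (I := NullNum 𝔽 𝕂) (NullFun 𝔽 𝕂 Ω)
    (RingHom.codRestrict
      (((Pi.constRingHom (Fin n → ℝ) 𝕂).compLeft (TestFn 𝔽)).comp (ModNum 𝔽 𝕂).subtype)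
      (ModFun 𝔽 𝕂 Ω)
      (fun a => ⟨fun φ => contDiffOn_const, fun K _ _ k => by
        obtain ⟨N, hN⟩ := a.2
        refine ModOn.mono (w := fun φ _ => ‖a.1 φ‖) ⟨N, fun φ hφ => ?_⟩
          (fun φ x _ => norm_iterated_const 𝕂 (a.1 φ) k x)
        obtain ⟨c, hc, η, h0, h1, H⟩ := hN φ hφ
        exact ⟨c, hc, η, h0, h1, fun ε e0 e1 _ _ => H ε e0 e1 () trivial⟩⟩))
    (fun a ha => fun K _ _ k => by
      obtain ⟨N, γ, hγ, hN⟩ := ha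
      refine NullOn.mono (w := fun φ _ => ‖a.1 φ‖) ⟨N, γ, hγ, fun q hq φ hφ => ?_⟩
        (fun φ x _ => norm_iterated_const 𝕂 (a.1 φ) k x)
      obtain ⟨c, hc, η, h0, h1, H⟩ := hN q hq φ hφ
      exact ⟨c, hc, η, h0, h1, fun ε e0 e1 _ _ => H ε e0 e1 () trivial⟩)

instance : Algebra (GenNum 𝔽 𝕂) (GenFun 𝔽 𝕂 Ω) := (constHom 𝔽 𝕂 Ω).toAlgebra

variable {𝔽 𝕂 Ω}

/-- The order of vanishing `V_{K,l}(f)`: the supremum of all `r ∈ ℝ` such that, for some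
(equivalently, every) representative `u`, there is `p` such that, for every `φ ∈ 𝒜_p`,
`i(φ_ε)^{-r} ∂^α u_{φ_ε} → 0` as `ε ↓ 0`, uniformly on `K`, for all `|α| ≤ l`. -/
def GenFun.val (K : Set (Fin n → ℝ)) (l : ℕ) (f : GenFun 𝔽 𝕂 Ω) : EReal :=
  sSup ((fun r : ℝ => (r : EReal)) '' {r : ℝ | ∃ u : ModFun 𝔽 𝕂 Ω, GenFun.mk 𝔽 𝕂 Ω u = f ∧
    ∃ p : ℕ, ∀ φ ∈ A 𝔽 p, ∀ k ≤ l, TendstoUniformlyOn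
      (fun (ε : ℝ) (x : Fin n → ℝ) =>
        (φ.scale ε).i ^ (-r) * ‖iteratedFDeriv ℝ k (u.1 (φ.scale ε)) x‖)
      (fun _ => 0) (𝓝[>] 0) K})

/-- The sharp seminorms `‖f‖_{K,l} = e^{-V_{K,l}(f)}`. -/
def GenFun.seminorm (K : Set (Fin n → ℝ)) (l : ℕ) (f : GenFun 𝔽 𝕂 Ω) : ℝ :=
  (EReal.exp (-GenFun.val K l f)).toReal

/-- The sharp topology on `𝒢(Ω)`, generated by the open balls of the ultra-pseudometrics
`‖f - g‖_{K,l}`, `K ⊆ Ω` compact, `l ∈ ℕ`. -/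
instance : TopologicalSpace (GenFun 𝔽 𝕂 Ω) :=
  TopologicalSpace.generateFrom
    {B | ∃ (K : Set (Fin n → ℝ)) (l : ℕ) (g : GenFun 𝔽 𝕂 Ω) (ρ : ℝ),
      IsCompact K ∧ K ⊆ Ω ∧ 0 < ρ ∧ B = {f | GenFun.seminorm K l (f - g) < ρ}}

theorem norm_iterated_partial {f : (Fin n → ℝ) → 𝕂} (hf : ContDiffOn ℝ ∞ f Ω) (i : Fin n) (k : ℕ)
    {x : Fin n → ℝ} (hx : x ∈ Ω) :
    ‖iteratedFDeriv ℝ k (fun y => fderiv ℝ f y (Pi.single i 1)) x‖ ≤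
      ‖(Pi.single i 1 : Fin n → ℝ)‖ * ‖iteratedFDeriv ℝ (k + 1) f x‖ := by
  have h1 : ContDiffAt ℝ ∞ f x := hf.contDiffAt (Ω.2.mem_nhds hx)
  have h2 : ContDiffAt ℝ k (fderiv ℝ f) x := h1.fderiv_right (by exact_mod_cast le_top)
  have h3 := norm_iteratedFDeriv_clm_apply_const (c := (Pi.single i 1 : Fin n → ℝ)) h2 (n := k) le_rfl
  rwa [norm_iteratedFDeriv_fderiv] at h3

/-- The partial derivative `∂/∂x_i` of a moderate net. -/
def ModFun.partialDeriv (i : Fin n) (u : ModFun 𝔽 𝕂 Ω) : ModFun 𝔽 𝕂 Ω :=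
  ⟨fun φ x => fderiv ℝ (u.1 φ) x (Pi.single i 1),
    fun φ => ((u.2.1 φ).fderiv_of_isOpen Ω.2 (by simp)).clm_apply contDiffOn_const,
    fun K hK hKΩ k => (ModOn.mul (ModOn.const ‖(Pi.single i 1 : Fin n → ℝ)‖)
      (u.2.2 K hK hKΩ (k + 1)) (fun _ _ _ => by positivity)).mono
      (fun φ x hx => norm_iterated_partial (u.2.1 φ) i k (hKΩ hx))⟩

/-- The partial derivative `∂/∂x_i` on `𝒢(Ω)`, defined on representatives. -/
def GenFun.partialDeriv (i : Fin n) (f : GenFun 𝔽 𝕂 Ω) : GenFun 𝔽 𝕂 Ω :=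
  Quotient.liftOn f (fun u => GenFun.mk 𝔽 𝕂 Ω (ModFun.partialDeriv i u)) (by
    intro u v huv
    have h : u - v ∈ NullFun 𝔽 𝕂 Ω := (Submodule.quotientRel_def _).1 huv
    refine Ideal.Quotient.eq.2 fun K hK hKΩ k => ?_
    refine (NullOn.mul (h K hK hKΩ (k + 1)) (ModOn.const ‖(Pi.single i 1 : Fin n → ℝ)‖)
      (fun _ _ _ => by positivity)).mono (fun φ x hx => ?_)
    rw [mul_comm]
    refine le_trans (le_of_eq ?_) (norm_iterated_partial ((u - v).2.1 φ) i k (hKΩ hx))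
    congr 1
    refine Filter.EventuallyEq.eq_of_nhds (Filter.EventuallyEq.iteratedFDeriv ℝ ?_ k)
    filter_upwards [Ω.2.mem_nhds (hKΩ hx)] with y hy
    have hu : DifferentiableAt ℝ (u.1 φ) y :=
      ((u.2.1 φ).contDiffAt (Ω.2.mem_nhds hy)).differentiableAt (by simp)
    have hv : DifferentiableAt ℝ (v.1 φ) y :=
      ((v.2.1 φ).contDiffAt (Ω.2.mem_nhds hy)).differentiableAt (by simp)
    change fderiv ℝ (u.1 φ) y (Pi.single i 1) - fderiv ℝ (v.1 φ) y (Pi.single i 1) =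
      fderiv ℝ (u.1 φ - v.1 φ) y (Pi.single i 1)
    rw [fderiv_sub hu hv]
    rfl)

end Functions

/-! ### Generalized points and generalized point values -/

section Points

variable {𝔽 : Type*} [RCLike 𝔽] {𝕂 : Type*} [RCLike 𝕂] {n : ℕ}
variable (Ω : TopologicalSpace.Opens (Fin n → ℝ))

/-- A net `x` of points with moderate coordinates is a compactly supported net in `Ω`:
`x_φ ∈ Ω` for all `φ`, and there are a compact `K ⊆ Ω` and `p` such that, for all `φ ∈ 𝒜_p`,
`x_{φ_ε} ∈ K` for all small `ε > 0`. -/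
def IsCompactNet (x : Fin n → ModNum 𝔽 ℝ) : Prop :=
  (∀ φ : TestFn 𝔽, (fun i => (x i).1 φ) ∈ Ω) ∧
  ∃ K : Set (Fin n → ℝ), IsCompact K ∧ K ⊆ Ω ∧ ∃ p : ℕ, ∀ φ ∈ A 𝔽 p,
    ∃ η : ℝ, 0 < η ∧ η ≤ 1 ∧ ∀ ε : ℝ, 0 < ε → ε < η → (fun i => (x i).1 (φ.scale ε)) ∈ K

variable (𝔽) in
/-- The set `Ω̃_c ⊆ ℝ̄ⁿ` of compactly supported generalized points of `Ω`. -/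
def CompactPoints : Set (Fin n → GenNum 𝔽 ℝ) :=
  {X | ∃ x : Fin n → ModNum 𝔽 ℝ, (∀ i, GenNum.mk (x i) = X i) ∧ IsCompactNet Ω x}

variable {Ω}

theorem eval_moderate (u : ModFun 𝔽 𝕂 Ω) {x : Fin n → ModNum 𝔽 ℝ} (hx : IsCompactNet Ω x) :
    (fun φ => u.1 φ (fun i => (x i).1 φ)) ∈ ModNum 𝔽 𝕂 := by
  obtain ⟨-, K, hK, hKΩ, p, hp⟩ := hx
  obtain ⟨N, hN⟩ := u.2.2 K hK hKΩ 0
  refine ⟨N + p, fun φ hφ => ?_⟩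
  obtain ⟨c, hc, η, h0, h1, H⟩ := hN φ (A_anti 𝔽 (by omega) hφ)
  obtain ⟨θ, k0, k1, L⟩ := hp φ (A_anti 𝔽 (by omega) hφ)
  refine ⟨c, hc, min η θ, lt_min h0 k0, (min_le_left _ _).trans h1, fun ε e0 e1 _ _ => ?_⟩
  have e2 : ε ≤ 1 := (e1.trans_le ((min_le_left _ _).trans h1)).le
  have := H ε e0 (e1.trans_le (min_le_left _ _)) _ (L ε e0 (e1.trans_le (min_le_right _ _)))
  beta_reduce at this
  rw [norm_iteratedFDeriv_zero] at this
  refine this.trans ?_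
  gcongr c * ?_
  exact Real.rpow_le_rpow_of_exponent_ge e0 e2
    (by push_cast; linarith [(Nat.cast_nonneg p : (0:ℝ) ≤ p)])

/-- The net `φ ↦ u_φ(x_φ)`. -/
def evalNet (u : ModFun 𝔽 𝕂 Ω) (x : Fin n → ModNum 𝔽 ℝ) (hx : IsCompactNet Ω x) : ModNum 𝔽 𝕂 :=
  ⟨fun φ => u.1 φ (fun i => (x i).1 φ), eval_moderate u hx⟩

theorem evalNet_congr_left {u v : ModFun 𝔽 𝕂 Ω} (h : u - v ∈ NullFun 𝔽 𝕂 Ω)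
    {x : Fin n → ModNum 𝔽 ℝ} (hx : IsCompactNet Ω x) :
    GenNum.mk (evalNet u x hx) = GenNum.mk (evalNet v x hx) := by
  rw [GenNum.mk_eq_mk]
  obtain ⟨-, K, hK, hKΩ, p, hp⟩ := hx
  obtain ⟨N, γ, hγ, hN⟩ := h K hK hKΩ 0
  refine ⟨N + p, γ, hγ, fun q hq φ hφ => ?_⟩
  obtain ⟨c, hc, η, h0, h1, H⟩ := hN q (by omega) φ hφ
  obtain ⟨θ, k0, k1, L⟩ := hp φ (A_anti 𝔽 (by omega) hφ)
  refine ⟨c, hc, min η θ, lt_min h0 k0, (min_le_left _ _).trans h1, fun ε e0 e1 _ _ => ?_⟩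
  have e2 : ε ≤ 1 := (e1.trans_le ((min_le_left _ _).trans h1)).le
  have := H ε e0 (e1.trans_le (min_le_left _ _)) _ (L ε e0 (e1.trans_le (min_le_right _ _)))
  beta_reduce at this
  rw [norm_iteratedFDeriv_zero] at this
  refine (show _ ≤ _ from this).trans ?_
  gcongr c * ?_
  exact Real.rpow_le_rpow_of_exponent_ge e0 e2
    (by push_cast; linarith [(Nat.cast_nonneg p : (0:ℝ) ≤ p)])

theorem evalNet_congr_right (u : ModFun 𝔽 𝕂 Ω) {x y : Fin n → ModNum 𝔽 ℝ}
    (hx : IsCompactNet Ω x) (hy : IsCompactNet Ω y)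
    (h : ∀ i, GenNum.mk (x i) = GenNum.mk (y i)) :
    GenNum.mk (evalNet u x hx) = GenNum.mk (evalNet u y hy) := by
  rw [GenNum.mk_eq_mk]
  -- the distance of the two nets of points is negligible
  have hd : NullOn (𝔽 := 𝔽) (Set.univ : Set Unit)
      (fun φ _ => ‖(fun i => (x i).1 φ) - (fun i => (y i).1 φ)‖) := by
    refine (NullOn.sum Finset.univ (fun i φ _ => ‖(x i).1 φ - (y i).1 φ‖)
      (fun i _ => GenNum.mk_eq_mk.1 (h i))).mono (fun φ _ _ => ?_)
    refine (pi_norm_le_iff_of_nonneg (Finset.sum_nonneg fun i _ => norm_nonneg _)).2 fun i => ?_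
    exact Finset.single_le_sum (f := fun i => ‖(x i).1 φ - (y i).1 φ‖)
      (fun i _ => norm_nonneg _) (Finset.mem_univ i)
  obtain ⟨P, γ, hγ, hP⟩ := hd
  obtain ⟨-, K, hK, hKΩ, p, hp⟩ := hx
  obtain ⟨W, hW, hKW, hWΩ⟩ := exists_compact_between hK Ω.2 hKΩ
  obtain ⟨δ, hδ, hδW⟩ := hK.exists_cthickening_subset_open isOpen_interior hKW
  obtain ⟨M, hM⟩ := u.2.2 W hW hWΩ 1
  obtain ⟨Q, hQ⟩ := (Filter.eventually_atTop.1 (hγ.2.2.eventually_gt_atTop (P : ℝ)))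
  refine ⟨P + p + M + Q, γ, hγ, fun q hq φ hφ => ?_⟩
  obtain ⟨c, hc, η, h0, h1, H⟩ := hP q (by omega) φ hφ
  obtain ⟨θ, k0, k1, L⟩ := hp φ (A_anti 𝔽 (by omega) hφ)
  obtain ⟨d, hd, τ, l0, l1, J⟩ := hM φ (A_anti 𝔽 (by omega) hφ)
  -- for small `ε` the two points are at distance at most `δ`
  have hsmall : ∀ᶠ ε : ℝ in 𝓝[>] 0, c * ε ^ (γ q - (P : ℝ)) < δ := by
    have hpos : 0 < γ q - (P : ℝ) := sub_pos.2 (hQ q (by omega))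
    have : Filter.Tendsto (fun ε : ℝ => c * ε ^ (γ q - (P : ℝ))) (𝓝 0) (𝓝 (c * 0 ^ (γ q - (P : ℝ)))) :=
      ((Real.continuousAt_rpow_const 0 _ (Or.inr hpos.le)).const_mul c)
    rw [Real.zero_rpow hpos.ne', mul_zero] at this
    exact (this.mono_left nhdsWithin_le_nhds).eventually_lt_const hδ
  obtain ⟨σ, s0, hσ⟩ := mem_nhdsGT_iff_exists_Ioo_subset.1 hsmall
  have s0' : (0 : ℝ) < σ := s0
  refine ⟨d * c, by positivity, min (min η θ) (min τ σ), lt_min (lt_min h0 k0) (lt_min l0 s0'),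
    (min_le_left _ _).trans ((min_le_left _ _).trans h1), fun ε e0 e1 _ _ => ?_⟩
  have eη : ε < η := e1.trans_le ((min_le_left _ _).trans (min_le_left _ _))
  have eθ : ε < θ := e1.trans_le ((min_le_left _ _).trans (min_le_right _ _))
  have eτ : ε < τ := e1.trans_le ((min_le_right _ _).trans (min_le_left _ _))
  have eσ : ε < σ := e1.trans_le ((min_le_right _ _).trans (min_le_right _ _))
  have e2 : ε ≤ 1 := (eη.trans_le h1).le
  set a : Fin n → ℝ := fun i => (x i).1 (φ.scale ε) with ha
  set b : Fin n → ℝ := fun i => (y i).1 (φ.scale ε) with hb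
  have haK : a ∈ K := L ε e0 eθ
  have hab : ‖a - b‖ ≤ c * ε ^ (γ q - (P : ℝ)) := H ε e0 eη () trivial
  have hδ' : c * ε ^ (γ q - (P : ℝ)) < δ := hσ ⟨e0, eσ⟩
  have hball : Metric.closedBall a δ ⊆ W :=
    (Metric.closedBall_subset_cthickening haK δ).trans (hδW.trans interior_subset)
  have hmv := (convex_closedBall a δ).norm_image_sub_le_of_norm_fderiv_le (𝕜 := ℝ)
    (f := u.1 (φ.scale ε)) (C := d * ε ^ (-(M : ℝ))) (x := b) (y := a)
    (fun z hz => ((u.2.1 _).contDiffAt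
      (Ω.2.mem_nhds (hWΩ (hball hz)))).differentiableAt (by simp))
    (fun z hz => by
      have := J ε e0 eτ z (hball hz)
      beta_reduce at this
      rwa [norm_iteratedFDeriv_one] at this)
    (by rw [mem_closedBall_iff_norm']; exact hab.trans hδ'.le)
    (Metric.mem_closedBall_self hδ.le)
  calc ‖(evalNet u x _).1 (φ.scale ε) - (evalNet u y _).1 (φ.scale ε)‖
      ≤ d * ε ^ (-(M : ℝ)) * ‖a - b‖ := hmv
    _ ≤ d * ε ^ (-(M : ℝ)) * (c * ε ^ (γ q - (P : ℝ))) := by gcongr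
    _ = d * c * ε ^ (-(M : ℝ) + (γ q - (P : ℝ))) := by rw [Real.rpow_add e0]; ring
    _ ≤ d * c * ε ^ (γ q - ((P + p + M + Q : ℕ) : ℝ)) := by
        gcongr d * c * ?_
        exact Real.rpow_le_rpow_of_exponent_ge e0 e2 (by
          push_cast
          linarith [(Nat.cast_nonneg p : (0:ℝ) ≤ p), (Nat.cast_nonneg Q : (0:ℝ) ≤ Q)])

/-- The map `κ`: `κ(f)(x̃) = f(x̃)` is the class of `φ ↦ u_φ(x_φ)`, for any representative `u` of `f`
and any compactly supported representative `x` of `x̃`; see `kappa_mk`. -/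
def kappa (f : GenFun 𝔽 𝕂 Ω) (X : CompactPoints 𝔽 Ω) : GenNum 𝔽 𝕂 :=
  Quotient.liftOn f (fun u => GenNum.mk (evalNet u X.2.choose X.2.choose_spec.2))
    (fun _ _ h => evalNet_congr_left ((Submodule.quotientRel_def _).1 h) _)

theorem kappa_mk (u : ModFun 𝔽 𝕂 Ω) (X : CompactPoints 𝔽 Ω) (x : Fin n → ModNum 𝔽 ℝ)
    (hX : ∀ i, GenNum.mk (x i) = X.1 i) (hx : IsCompactNet Ω x) :
    kappa (GenFun.mk 𝔽 𝕂 Ω u) X = GenNum.mk (evalNet u x hx) :=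
  evalNet_congr_right u X.2.choose_spec.2 hx
    (fun i => (X.2.choose_spec.1 i).trans (hX i).symm)

end Points

/-! ### Differential calculus over generalized numbers -/

section Calculus

variable {𝔽 : Type*} [RCLike 𝔽] {𝕂 : Type*} [RCLike 𝕂] {n : ℕ} {U : Set (Fin n → GenNum 𝔽 ℝ)}

/-- `f` is differentiable at `x₀` with derivative the vector `a = (a_1, …, a_n)`:
`(f(x) - f(x₀) - a · (x - x₀)) / β̇_{‖x - x₀‖} → 0` as `x → x₀`, `x ≠ x₀`. -/
def HasSharpDerivAt (f : U → GenNum 𝔽 𝕂) (a : Fin n → GenNum 𝔽 𝕂) (x₀ : U) : Prop :=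
  Filter.Tendsto
    (fun x : U => (f x - f x₀ - ∑ i, a i * GenNum.ofReal (x.1 i - x₀.1 i)) *
      (((betaDot 𝔽 𝕂 (sharpNormVec (x.1 - x₀.1)))⁻¹ : (GenNum 𝔽 𝕂)ˣ) : GenNum 𝔽 𝕂))
    (𝓝[≠] x₀) (𝓝 0)

/-- `f` has the partial derivative `a` with respect to `x_i` at `x₀`:
`(f(x₀ + h e_i) - f(x₀) - a h) / β̇_{‖h‖} → 0` as `h → 0` in `ℝ̄`, `h ≠ 0`, `x₀ + h e_i ∈ U`. -/
def HasSharpPartialAt (f : U → GenNum 𝔽 𝕂) (i : Fin n) (a : GenNum 𝔽 𝕂) (x₀ : U) : Prop :=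
  Filter.Tendsto
    (fun h : {h : GenNum 𝔽 ℝ // x₀.1 + Pi.single i h ∈ U} =>
      (f ⟨x₀.1 + Pi.single i h.1, h.2⟩ - f x₀ - a * GenNum.ofReal h.1) *
        (((betaDot 𝔽 𝕂 (sharpNorm h.1))⁻¹ : (GenNum 𝔽 𝕂)ˣ) : GenNum 𝔽 𝕂))
    (Filter.comap Subtype.val (𝓝[≠] 0)) (𝓝 0)

open Classical in
/-- The partial derivative `∂f/∂x_i` (with dummy value `0` where it does not exist). -/
def sharpPartial (f : U → GenNum 𝔽 𝕂) (i : Fin n) (x₀ : U) : GenNum 𝔽 𝕂 :=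
  if h : ∃ a, HasSharpPartialAt f i a x₀ then h.choose else 0

variable (𝕂 U) in
/-- `𝒞¹(U; 𝕂̄)`: the continuous functions all of whose partial derivatives exist everywhere on `U`
and are continuous. -/
def SharpC1 : Set (U → GenNum 𝔽 𝕂) :=
  {f | Continuous f ∧ ∀ i, (∀ x₀, ∃ a, HasSharpPartialAt f i a x₀) ∧ Continuous (sharpPartial f i)}

end Calculus

end Colombeau

end

open Colombeau

/-!
Everything is read off from rates of decay of nets. `DecaysAt v r` says that `v(φ_ε) = o(ε^r)` for
all `φ` in some `𝒜_p`, and by `sharpNorm_mk_le` and `decaysAt_of_sharpNorm_mk_lt` the sharp norm of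
the class of `v` is the infimum of the `e^{-r}` with `DecaysAt v r`. Moderate nets have some rate,
which keeps the norm away from the junk value of `exp ∞`, and a net that has every rate is
negligible (`nullOn_of_forall_decaysAt`). Hence the sharp norm is a ring norm, its topology is the
sharp topology, and `GenNum` is a Hausdorff topological ring.

Openness: if `‖y - x‖ < 1` then `|y_{φ_ε} - x_{φ_ε}| → 0`, so a net representing `y` eventually stays
in a compact neighbourhood of the compact set carrying `x`, and may be redefined where it leaves `Ω`.

Differentiability: on a compact neighbourhood `W` of that set the derivatives of `u_φ` of order one
and two are `O(ε^{-M})`. The mean value inequality and Taylor's formula for `u_{φ_ε}` then give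
`‖κ(f)(y) - κ(f)(x)‖ ≤ C ‖y - x‖` and a remainder of norm at most `C ‖y - x‖²`, with `C = e^M`
(`exists_kappa_bound`). As `‖z / β̇_s‖ ≤ ‖z‖ / s`, this is continuity and differentiability.
Partial derivatives are unique, because `α̇_k → 0` and `α̇_k / β̇_{‖α̇_k‖} = 1`
(`HasSharpPartialAt.unique`); with the product rule, `𝒞¹` is an algebra.

Continuity of `κ` is the inequality `‖κ(f)(x)‖ ≤ ‖f‖_{K,0}`, for `K` carrying `x`
(`sharpNorm_kappa_le`). For injectivity, choosing `x_φ ∈ K` with `|u_φ(x_φ)| = max_K |u_φ|` shows that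
`sup_K |u_φ|` is negligible if `κ(f) = 0`, and Landau's inequality between the derivatives of orders
`k`, `k + 1` and `k + 2` extends this to all derivatives (`mem_nullFun_of_nullOn`).
-/

namespace Colombeau

open Filter Set

/-! ### Decay rates of nets -/

section Decay

variable {𝔽 : Type*} [RCLike 𝔽]

/-- The net `v` is `o(ε^r)`: for some `p` and every `φ ∈ 𝒜_p`, `ε^{-r} v(φ_ε) → 0` as `ε ↓ 0`. -/
def DecaysAt (v : TestFn 𝔽 → ℝ) (r : ℝ) : Prop :=
  ∃ p : ℕ, ∀ φ ∈ A 𝔽 p, Tendsto (fun ε : ℝ => ε ^ (-r) * v (φ.scale ε)) (𝓝[>] 0) (𝓝 0)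

theorem tendsto_rpow_nhdsGT_zero {s : ℝ} (hs : 0 < s) :
    Tendsto (fun ε : ℝ => ε ^ s) (𝓝[>] 0) (𝓝 0) := by
  have := (Real.continuousAt_rpow_const 0 s (Or.inr hs.le)).tendsto
  rw [Real.zero_rpow hs.ne'] at this
  exact this.mono_left nhdsWithin_le_nhds

theorem eventually_pos : ∀ᶠ ε : ℝ in 𝓝[>] 0, 0 < ε := self_mem_nhdsWithin

theorem eventually_lt {η : ℝ} (h : 0 < η) : ∀ᶠ ε : ℝ in 𝓝[>] 0, ε < η :=
  (eventually_lt_nhds h).filter_mono nhdsWithin_le_nhds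

theorem DecaysAt.of_le {v w : TestFn 𝔽 → ℝ} {r : ℝ} (hw : DecaysAt w r) (hv : ∀ φ, 0 ≤ v φ)
    (h : ∃ p : ℕ, ∀ φ ∈ A 𝔽 p, ∀ᶠ ε : ℝ in 𝓝[>] 0, v (φ.scale ε) ≤ w (φ.scale ε)) :
    DecaysAt v r := by
  obtain ⟨p, hp⟩ := hw
  obtain ⟨q, hq⟩ := h
  refine ⟨p + q, fun φ hφ => ?_⟩
  refine tendsto_of_tendsto_of_tendsto_of_le_of_le' tendsto_const_nhds
    (hp φ (A_anti 𝔽 (by omega) hφ)) ?_ ?_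
  · filter_upwards [eventually_pos] with ε e0
    exact mul_nonneg (Real.rpow_nonneg e0.le _) (hv _)
  · filter_upwards [eventually_pos, hq φ (A_anti 𝔽 (by omega) hφ)] with ε e0 e1
    exact mul_le_mul_of_nonneg_left e1 (Real.rpow_nonneg e0.le _)

theorem DecaysAt.add {v w : TestFn 𝔽 → ℝ} {r : ℝ} (hv : DecaysAt v r) (hw : DecaysAt w r) :
    DecaysAt (fun φ => v φ + w φ) r := by
  obtain ⟨p, hp⟩ := hv
  obtain ⟨q, hq⟩ := hw
  refine ⟨p + q, fun φ hφ => ?_⟩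
  simpa [mul_add] using
    (hp φ (A_anti 𝔽 (by omega) hφ)).add (hq φ (A_anti 𝔽 (by omega) hφ))

theorem DecaysAt.zero (r : ℝ) : DecaysAt (fun _ : TestFn 𝔽 => 0) r := ⟨0, by simp⟩

theorem DecaysAt.sum {κ : Type*} (s : Finset κ) {v : κ → TestFn 𝔽 → ℝ} {r : ℝ}
    (h : ∀ k ∈ s, DecaysAt (v k) r) : DecaysAt (fun φ => ∑ k ∈ s, v k φ) r := by
  classical
  induction s using Finset.induction_on with
  | empty => simpa using DecaysAt.zero r
  | insert a s ha ih =>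
    simp only [Finset.sum_insert ha]
    exact (h a (by simp)).add (ih fun k hk => h k (by simp [hk]))

theorem DecaysAt.mul {v w : TestFn 𝔽 → ℝ} {r s : ℝ} (hv : DecaysAt v r) (hw : DecaysAt w s) :
    DecaysAt (fun φ => v φ * w φ) (r + s) := by
  obtain ⟨p, hp⟩ := hv
  obtain ⟨q, hq⟩ := hw
  refine ⟨p + q, fun φ hφ => ?_⟩
  have := (hp φ (A_anti 𝔽 (by omega) hφ)).mul (hq φ (A_anti 𝔽 (by omega) hφ))
  rw [mul_zero] at this
  refine this.congr' ?_
  filter_upwards [eventually_pos] with ε e0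
  rw [neg_add, Real.rpow_add e0]
  ring

/-- A net that is `O(ε^s)` is `o(ε^r)` for every `r < s`. -/
theorem DecaysAt.of_bound {v : TestFn 𝔽 → ℝ} {r s : ℝ} (hv : ∀ φ, 0 ≤ v φ) (hrs : r < s)
    (h : ∃ p : ℕ, ∀ φ ∈ A 𝔽 p, ∃ c : ℝ, ∀ᶠ ε : ℝ in 𝓝[>] 0, v (φ.scale ε) ≤ c * ε ^ s) :
    DecaysAt v r := by
  obtain ⟨p, hp⟩ := h
  refine ⟨p, fun φ hφ => ?_⟩
  obtain ⟨c, hc⟩ := hp φ hφ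
  have ht := (tendsto_rpow_nhdsGT_zero (sub_pos.2 hrs)).const_mul c
  rw [mul_zero] at ht
  refine tendsto_of_tendsto_of_tendsto_of_le_of_le' tendsto_const_nhds ht ?_ ?_
  · filter_upwards [eventually_pos] with ε e0
    exact mul_nonneg (Real.rpow_nonneg e0.le _) (hv _)
  · filter_upwards [eventually_pos, hc] with ε e0 e1
    refine (mul_le_mul_of_nonneg_left e1 (Real.rpow_nonneg e0.le _)).trans_eq ?_
    rw [sub_eq_neg_add, Real.rpow_add e0]
    ring

theorem DecaysAt.eventually_le {v : TestFn 𝔽 → ℝ} {r : ℝ} (h : DecaysAt v r) :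
    ∃ p : ℕ, ∀ φ ∈ A 𝔽 p, ∀ᶠ ε : ℝ in 𝓝[>] 0, v (φ.scale ε) ≤ 1 * ε ^ r := by
  obtain ⟨p, hp⟩ := h
  refine ⟨p, fun φ hφ => ?_⟩
  filter_upwards [eventually_pos, (hp φ hφ).eventually_lt_const one_pos] with ε e0 e1
  have h2 : ε ^ r * (ε ^ (-r) * v (φ.scale ε)) ≤ ε ^ r * 1 := by gcongr
  rwa [← mul_assoc, ← Real.rpow_add e0, add_neg_cancel, Real.rpow_zero, one_mul, mul_comm] at h2

theorem DecaysAt.anti {v : TestFn 𝔽 → ℝ} {r s : ℝ} (hv : ∀ φ, 0 ≤ v φ) (h : DecaysAt v s)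
    (hrs : r ≤ s) : DecaysAt v r := by
  rcases hrs.eq_or_lt with rfl | hrs
  · exact h
  · obtain ⟨p, hp⟩ := h.eventually_le
    exact .of_bound hv hrs ⟨p, fun φ hφ => ⟨1, hp φ hφ⟩⟩

/-- A moderate net is `o(ε^r)` for some (negative) `r`, so that its valuation is not `-∞`. -/
theorem exists_decaysAt_of_modOn {v : TestFn 𝔽 → ℝ} (hv : ∀ φ, 0 ≤ v φ)
    (h : ModOn (univ : Set Unit) (fun φ _ => v φ)) : ∃ r, DecaysAt v r := by
  obtain ⟨N, hN⟩ := h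
  refine ⟨-(N : ℝ) - 1, .of_bound hv (sub_one_lt _) ⟨N, fun φ hφ => ?_⟩⟩
  obtain ⟨c, -, η, h0, -, H⟩ := hN φ hφ
  refine ⟨c, ?_⟩
  filter_upwards [eventually_pos, eventually_lt h0] with ε e0 e1
  exact H ε e0 e1 () trivial

theorem decaysAt_of_nullOn {v : TestFn 𝔽 → ℝ} (hv : ∀ φ, 0 ≤ v φ)
    (h : NullOn (univ : Set Unit) (fun φ _ => v φ)) (r : ℝ) : DecaysAt v r := by
  obtain ⟨N, γ, hγ, hN⟩ := h
  obtain ⟨q, hq1, hq⟩ := ((hγ.2.2.eventually_gt_atTop (r + N)).and (eventually_ge_atTop N)).exists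
  refine .of_bound hv (s := γ q - N) (by linarith) ⟨q, fun φ hφ => ?_⟩
  obtain ⟨c, -, η, h0, -, H⟩ := hN q hq φ hφ
  refine ⟨c, ?_⟩
  filter_upwards [eventually_pos, eventually_lt h0] with ε e0 e1
  exact H ε e0 e1 () trivial

/-- A net that decays faster than every power of `ε` is negligible. If `φ ∈ 𝒜_{p k}` guarantees the
rate `k`, then `γ(q)` may be taken close to the largest `k ≤ q` with `p k ≤ q`. -/
theorem nullOn_of_forall_decaysAt {v : TestFn 𝔽 → ℝ} (h : ∀ r, DecaysAt v r) :
    NullOn (univ : Set Unit) (fun φ _ => v φ) := by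
  choose p hp using fun k : ℕ => (h k).eventually_le
  -- `m q` is the largest `k ≤ q` with `p k ≤ q`; the last summand makes `γ` strictly increasing
  let m : ℕ → ℕ := fun q => Nat.findGreatest (fun k => p k ≤ q) q
  have hm : Monotone m := fun a b hab =>
    Nat.findGreatest_mono (fun k (hk : p k ≤ a) => hk.trans hab) hab
  have hmt : Tendsto m atTop atTop := by
    refine tendsto_atTop_atTop.2 fun b => ⟨max b (p b), fun a ha => ?_⟩
    exact Nat.le_findGreatest ((le_max_left _ _).trans ha) ((le_max_right _ _).trans ha)
  have hlt : ∀ q : ℕ, (0 : ℝ) < 1 / ((q : ℝ) + 1) ∧ 1 / ((q : ℝ) + 1) ≤ 1 := fun q =>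
    ⟨by positivity, by rw [div_le_one (by positivity)]; linarith [(Nat.cast_nonneg q : (0:ℝ) ≤ q)]⟩
  refine ⟨max 1 (p 0), fun q => m q + (1 - 1 / ((q : ℝ) + 1)),
    ⟨fun q => ?_, fun a b hab => ?_, ?_⟩, fun q hq φ hφ => ?_⟩
  · have := (hlt q).2
    have : (0 : ℝ) ≤ m q := Nat.cast_nonneg _
    linarith
  · have h1 : (m a : ℝ) ≤ m b := by exact_mod_cast hm hab.le
    have h2 : 1 / ((b : ℝ) + 1) < 1 / ((a : ℝ) + 1) := by gcongr
    change (m a : ℝ) + (1 - 1 / ((a : ℝ) + 1)) < (m b : ℝ) + (1 - 1 / ((b : ℝ) + 1))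
    linarith
  · refine tendsto_atTop_mono (fun q => ?_) (tendsto_natCast_atTop_atTop.comp hmt)
    have := (hlt q).2
    simp only [Function.comp]
    linarith
  · have hpm : p (m q) ≤ q :=
      Nat.findGreatest_spec (P := fun k => p k ≤ q) (Nat.zero_le q) ((le_max_right _ _).trans hq)
    obtain ⟨η, h0, H⟩ := mem_nhdsGT_iff_exists_Ioo_subset.1 (hp (m q) φ (A_anti 𝔽 hpm hφ))
    refine ⟨1, one_pos, min η 1, lt_min h0 one_pos, min_le_right _ _, fun ε e0 e1 _ _ => ?_⟩
    refine (show _ ≤ _ from H ⟨e0, e1.trans_le (min_le_left _ _)⟩).trans ?_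
    gcongr 1 * ?_
    refine Real.rpow_le_rpow_of_exponent_ge e0 (e1.le.trans (min_le_right _ _)) ?_
    have h1 : (1 : ℝ) ≤ ((max 1 (p 0) : ℕ) : ℝ) := by exact_mod_cast le_max_left _ _
    have := (hlt q).1
    change (m q : ℝ) + (1 - 1 / ((q : ℝ) + 1)) - _ ≤ _
    linarith

end Decay

/-! ### The sharp norm -/

section ExpSup

theorem toReal_exp_neg_sSup_le {S : Set ℝ} {r : ℝ} (hr : r ∈ S) :
    (EReal.exp (-sSup ((fun r : ℝ => (r : EReal)) '' S))).toReal ≤ Real.exp (-r) := by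
  have h : EReal.exp (-sSup ((fun r : ℝ => (r : EReal)) '' S)) ≤ ENNReal.ofReal (Real.exp (-r)) := by
    rw [← EReal.exp_coe, EReal.exp_le_exp_iff, EReal.coe_neg, EReal.neg_le_neg_iff]
    exact le_sSup (mem_image_of_mem _ hr)
  exact ENNReal.toReal_le_of_le_ofReal (Real.exp_pos _).le h

/-- The nonemptiness of `S` excludes the value `exp ∞`, whose real part is `0`. -/
theorem exists_lt_of_toReal_exp_neg_sSup_lt {S : Set ℝ} (hS : S.Nonempty) {r : ℝ}
    (h : (EReal.exp (-sSup ((fun r : ℝ => (r : EReal)) '' S))).toReal < Real.exp (-r)) :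
    ∃ s ∈ S, r < s := by
  obtain ⟨t, ht⟩ := hS
  have hfin : EReal.exp (-sSup ((fun r : ℝ => (r : EReal)) '' S)) ≠ ⊤ := by
    rw [Ne, EReal.exp_eq_top_iff, EReal.neg_eq_top_iff]
    exact ((EReal.bot_lt_coe t).trans_le (le_sSup (mem_image_of_mem _ ht))).ne'
  rw [← ENNReal.lt_ofReal_iff_toReal_lt hfin, ← EReal.exp_coe, EReal.exp_lt_exp_iff, EReal.coe_neg,
    EReal.neg_lt_neg_iff, lt_sSup_iff] at h
  obtain ⟨-, ⟨s, hs, rfl⟩, h⟩ := h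
  exact ⟨s, hs, EReal.coe_lt_coe_iff.1 h⟩

/-- To bound a real number by `g a`, `a ≥ 0`, it suffices to bound it by `g (e^{-r})` for all
`e^{-r} > a`. -/
theorem le_apply_of_forall_lt_exp {a b : ℝ} (ha : 0 ≤ a) {g : ℝ → ℝ} (hg : Continuous g)
    (h : ∀ r, a < Real.exp (-r) → b ≤ g (Real.exp (-r))) : b ≤ g a := by
  refine ge_of_tendsto ((hg.tendsto a).mono_left (nhdsWithin_le_nhds (s := Ioi a))) ?_
  filter_upwards [self_mem_nhdsWithin] with t ht
  have := h (-Real.log t)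
  rw [neg_neg, Real.exp_log (ha.trans_lt ht)] at this
  exact this ht

theorem le_of_forall_lt_exp {a b : ℝ} (ha : 0 ≤ a)
    (h : ∀ r, a < Real.exp (-r) → b ≤ Real.exp (-r)) : b ≤ a :=
  le_apply_of_forall_lt_exp ha continuous_id h

end ExpSup

section Norm

variable {𝔽 : Type*} [RCLike 𝔽] {F : Type*} [RCLike F]

theorem assocZero_alphaDot_mul_iff (v : ModNum 𝔽 F) (r : ℝ) :
    AssocZero (alphaDot 𝔽 F (-r) * GenNum.mk v) ↔ DecaysAt (fun φ => ‖v.1 φ‖) r := by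
  let w : ModNum 𝔽 F := ⟨fun φ => ((φ.i ^ (-r) : ℝ) : F), alpha_mem (-r)⟩ * v
  have hw : alphaDot 𝔽 F (-r) * GenNum.mk v = GenNum.mk w := by
    rw [alphaDot, ← map_mul]
  have hnorm : ∀ (φ : TestFn 𝔽) (ε : ℝ), 0 < ε →
      ‖w.1 (φ.scale ε)‖ = φ.i ^ (-r) * (ε ^ (-r) * ‖v.1 (φ.scale ε)‖) := by
    intro φ ε e0
    change ‖(((φ.scale ε).i ^ (-r) : ℝ) : F) * v.1 (φ.scale ε)‖ = _
    have := φ.i_pos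
    rw [norm_mul, RCLike.norm_ofReal, φ.i_scale e0, Real.mul_rpow e0.le this.le,
      abs_of_nonneg (by positivity)]
    ring
  rw [hw]
  constructor
  · rintro ⟨x, hx, p, hp⟩
    -- passing from the given representative to `w` costs a negligible error
    obtain ⟨q, hq⟩ := decaysAt_of_nullOn (fun φ => norm_nonneg _) (GenNum.mk_eq_mk.1 hx) 0
    refine ⟨p + q, fun φ hφ => ?_⟩
    have h1 := hp φ (A_anti 𝔽 (by omega) hφ)
    have h2 := hq φ (A_anti 𝔽 (by omega) hφ)
    simp only [neg_zero, Real.rpow_zero, one_mul] at h2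
    have h3 := h1.sub (tendsto_zero_iff_norm_tendsto_zero.2 h2)
    simp only [sub_sub_cancel, sub_zero] at h3
    have h4 := (tendsto_zero_iff_norm_tendsto_zero.1 h3).const_mul (φ.i ^ r)
    rw [mul_zero] at h4
    refine h4.congr' ?_
    filter_upwards [eventually_pos] with ε e0
    rw [hnorm φ ε e0, ← mul_assoc, ← Real.rpow_add φ.i_pos, add_neg_cancel, Real.rpow_zero, one_mul]
  · rintro ⟨p, hp⟩
    refine ⟨w, rfl, p, fun φ hφ => tendsto_zero_iff_norm_tendsto_zero.2 ?_⟩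
    have h4 := (hp φ hφ).const_mul (φ.i ^ (-r))
    rw [mul_zero] at h4
    refine h4.congr' ?_
    filter_upwards [eventually_pos] with ε e0
    rw [hnorm φ ε e0]

theorem sharpNorm_mk_le {v : ModNum 𝔽 F} {r : ℝ} (h : DecaysAt (fun φ => ‖v.1 φ‖) r) :
    sharpNorm (GenNum.mk v) ≤ Real.exp (-r) :=
  toReal_exp_neg_sSup_le (S := {r | AssocZero (alphaDot 𝔽 F (-r) * GenNum.mk v)})
    ((assocZero_alphaDot_mul_iff v r).2 h)

theorem decaysAt_of_sharpNorm_mk_lt {v : ModNum 𝔽 F} {r : ℝ}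
    (h : sharpNorm (GenNum.mk v) < Real.exp (-r)) : DecaysAt (fun φ => ‖v.1 φ‖) r := by
  obtain ⟨s, hs⟩ := exists_decaysAt_of_modOn (fun φ => norm_nonneg (v.1 φ)) v.2
  obtain ⟨t, ht, hrt⟩ := exists_lt_of_toReal_exp_neg_sSup_lt
    (S := {r | AssocZero (alphaDot 𝔽 F (-r) * GenNum.mk v)})
    ⟨s, (assocZero_alphaDot_mul_iff v s).2 hs⟩ h
  exact ((assocZero_alphaDot_mul_iff v t).1 ht).anti (fun φ => norm_nonneg _) hrt.le

theorem sharpNorm_nonneg (x : GenNum 𝔽 F) : 0 ≤ sharpNorm x := ENNReal.toReal_nonneg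

theorem sharpNorm_zero : sharpNorm (0 : GenNum 𝔽 F) = 0 := by
  refine le_antisymm (le_of_forall_lt_exp le_rfl fun r _ => ?_) (sharpNorm_nonneg _)
  rw [← map_zero GenNum.mk]
  exact sharpNorm_mk_le (by simpa using DecaysAt.zero r)

theorem eq_zero_of_sharpNorm_eq_zero {x : GenNum 𝔽 F} (h : sharpNorm x = 0) : x = 0 := by
  obtain ⟨v, rfl⟩ := GenNum.mk_surjective x
  rw [← map_zero GenNum.mk, GenNum.mk_eq_mk]
  simpa using nullOn_of_forall_decaysAt fun r =>
    decaysAt_of_sharpNorm_mk_lt (h.trans_lt (Real.exp_pos (-r)))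

theorem sharpNorm_neg (x : GenNum 𝔽 F) : sharpNorm (-x) = sharpNorm x := by
  have h : ∀ x : GenNum 𝔽 F, sharpNorm (-x) ≤ sharpNorm x := fun x => by
    obtain ⟨v, rfl⟩ := GenNum.mk_surjective x
    refine le_of_forall_lt_exp (sharpNorm_nonneg _) fun r hr => ?_
    rw [← map_neg]
    exact sharpNorm_mk_le (by simpa using decaysAt_of_sharpNorm_mk_lt hr)
  exact (h x).antisymm (by simpa using h (-x))

theorem sharpNorm_add_le_max (x y : GenNum 𝔽 F) :
    sharpNorm (x + y) ≤ max (sharpNorm x) (sharpNorm y) := by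
  obtain ⟨v, rfl⟩ := GenNum.mk_surjective x
  obtain ⟨w, rfl⟩ := GenNum.mk_surjective y
  refine le_of_forall_lt_exp (le_max_of_le_left (sharpNorm_nonneg _)) fun r hr => ?_
  rw [max_lt_iff] at hr
  rw [← map_add]
  exact sharpNorm_mk_le
    (((decaysAt_of_sharpNorm_mk_lt hr.1).add (decaysAt_of_sharpNorm_mk_lt hr.2)).of_le
      (fun φ => norm_nonneg _) ⟨0, fun φ _ => .of_forall fun ε => norm_add_le _ _⟩)

theorem sharpNorm_mul_le (x y : GenNum 𝔽 F) :
    sharpNorm (x * y) ≤ sharpNorm x * sharpNorm y := by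
  obtain ⟨v, rfl⟩ := GenNum.mk_surjective x
  obtain ⟨w, rfl⟩ := GenNum.mk_surjective y
  refine le_apply_of_forall_lt_exp (g := fun t => t * sharpNorm (GenNum.mk w)) (sharpNorm_nonneg _)
    (by fun_prop) fun r hr => ?_
  refine le_apply_of_forall_lt_exp (g := fun t => Real.exp (-r) * t) (sharpNorm_nonneg _)
    (by fun_prop) fun s hs => ?_
  rw [← map_mul, ← Real.exp_add, ← neg_add]
  exact sharpNorm_mk_le (v := v * w)
    (by simpa using (decaysAt_of_sharpNorm_mk_lt hr).mul (decaysAt_of_sharpNorm_mk_lt hs))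

variable (𝔽 F) in
/-- The generalized numbers with the sharp norm. This is not an instance, since `GenNum` already
carries a topology; that it is the topology of this norm is `topology_eq`. -/
noncomputable abbrev sharpNormedRing : NormedCommRing (GenNum 𝔽 F) where
  __ := (inferInstance : CommRing (GenNum 𝔽 F))
  __ := RingNorm.toNormedRing
    { toFun := sharpNorm
      map_zero' := sharpNorm_zero
      add_le' := fun x y => (sharpNorm_add_le_max x y).trans
        (max_le_add_of_nonneg (sharpNorm_nonneg x) (sharpNorm_nonneg y))
      neg' := sharpNorm_neg
      mul_le' := sharpNorm_mul_le
      eq_zero_of_map_eq_zero' := fun _ => eq_zero_of_sharpNorm_eq_zero : RingNorm (GenNum 𝔽 F) }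

theorem topology_eq : (inferInstance : TopologicalSpace (GenNum 𝔽 F)) =
    (sharpNormedRing 𝔽 F).toMetricSpace.toPseudoMetricSpace.toUniformSpace.toTopologicalSpace := by
  let M := (sharpNormedRing 𝔽 F).toMetricSpace.toPseudoMetricSpace
  have hd : ∀ x y : GenNum 𝔽 F, M.dist x y = sharpNorm (x - y) := fun x y => by
    change sharpNorm (-x + y) = _
    rw [← sharpNorm_neg]
    congr 1
    ring
  refine le_antisymm ?_ ?_
  · intro s hs
    refine (@isOpen_iff_forall_mem_open _ _ s).2 fun x hx => ?_
    obtain ⟨ρ, hρ, h⟩ := Metric.isOpen_iff.1 hs x hx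
    refine ⟨{y | sharpNorm (y - x) < ρ}, fun y hy => h ?_,
      TopologicalSpace.isOpen_generateFrom_of_mem ⟨x, ρ, hρ, rfl⟩, ?_⟩
    · exact (hd y x).trans_lt hy
    · simpa [sharpNorm_zero] using hρ
  · refine le_generateFrom ?_
    rintro _ ⟨a, ρ, -, rfl⟩
    have : {x | sharpNorm (x - a) < ρ} = Metric.ball a ρ := by
      ext x
      rw [Metric.mem_ball, mem_ofPred_eq]
      exact (hd x a).symm ▸ Iff.rfl
    rw [this]
    exact Metric.isOpen_ball

theorem nhds_hasBasis_sharpNorm (a : GenNum 𝔽 F) :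
    (𝓝 a).HasBasis (fun ρ : ℝ => 0 < ρ) fun ρ => {x | sharpNorm (x - a) < ρ} := by
  refine ⟨fun s => ⟨fun hs => ?_, fun ⟨ρ, hρ, h⟩ => ?_⟩⟩
  · obtain ⟨t, hts, ht, hat⟩ := mem_nhds_iff.1 hs
    let := (sharpNormedRing 𝔽 F).toMetricSpace.toPseudoMetricSpace
    have ht' : IsOpen[(sharpNormedRing 𝔽 F).toMetricSpace.toPseudoMetricSpace.toUniformSpace.toTopologicalSpace] t :=
      topology_eq (𝔽 := 𝔽) (F := F) ▸ ht
    obtain ⟨ρ, hρ, h⟩ := Metric.isOpen_iff.1 ht' a hat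
    refine ⟨ρ, hρ, fun y hy => hts (h ?_)⟩
    change sharpNorm (-y + a) < ρ
    rwa [← sharpNorm_neg, neg_add, neg_neg, ← sub_eq_add_neg]
  · refine mem_of_superset ((TopologicalSpace.isOpen_generateFrom_of_mem
      ⟨a, ρ, hρ, rfl⟩ : IsOpen {x | sharpNorm (x - a) < ρ}).mem_nhds ?_) h
    simpa [sharpNorm_zero] using hρ

instance : IsTopologicalRing (GenNum 𝔽 F) := by
  have h := topology_eq (𝔽 := 𝔽) (F := F)
  let := sharpNormedRing 𝔽 F
  have h2 : @IsTopologicalRing (GenNum 𝔽 F) (sharpNormedRing 𝔽 F).toMetricSpace.toPseudoMetricSpace.toUniformSpace.toTopologicalSpace _ := inferInstance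
  rw [← h] at h2
  exact h2

theorem tendsto_nhds_iff_sharpNorm {α : Type*} {l : Filter α} {f : α → GenNum 𝔽 F}
    {a : GenNum 𝔽 F} : Tendsto f l (𝓝 a) ↔ Tendsto (fun x => sharpNorm (f x - a)) l (𝓝 0) := by
  rw [(nhds_hasBasis_sharpNorm a).tendsto_right_iff, Metric.tendsto_nhds]
  simp only [Real.dist_0_eq_abs, abs_of_nonneg (sharpNorm_nonneg _), mem_ofPred_eq]

end Norm

section Norm

variable {𝔽 : Type*} [RCLike 𝔽] {F : Type*} [RCLike F]

theorem ofReal_mem_modNum (a : ModNum 𝔽 ℝ) : (fun φ => ((a.1 φ : ℝ) : F)) ∈ ModNum 𝔽 F := by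
  have h : ModOn (univ : Set Unit) (fun φ _ => ‖a.1 φ‖) := a.2
  change ModOn (univ : Set Unit) (fun φ _ => ‖((a.1 φ : ℝ) : F)‖)
  simpa using h

theorem GenNum.ofReal_mk (a : ModNum 𝔽 ℝ) : GenNum.ofReal (GenNum.mk a) =
    GenNum.mk (F := F) ⟨fun φ => ((a.1 φ : ℝ) : F), ofReal_mem_modNum a⟩ := rfl

theorem sharpNorm_ofReal_le (x : GenNum 𝔽 ℝ) :
    sharpNorm (GenNum.ofReal x : GenNum 𝔽 F) ≤ sharpNorm x := by
  obtain ⟨v, rfl⟩ := GenNum.mk_surjective x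
  refine le_of_forall_lt_exp (sharpNorm_nonneg _) fun r hr => ?_
  rw [GenNum.ofReal_mk]
  exact sharpNorm_mk_le (by simpa using decaysAt_of_sharpNorm_mk_lt hr)

theorem ofReal_alphaDot (r : ℝ) : GenNum.ofReal (alphaDot 𝔽 ℝ r) = alphaDot 𝔽 F r := rfl

theorem sharpNorm_alphaDot_le (r : ℝ) : sharpNorm (alphaDot 𝔽 F r) ≤ Real.exp (-r) := by
  refine le_of_forall_lt_exp (Real.exp_pos _).le fun s hs => sharpNorm_mk_le ?_
  have hs : s < r := by simpa using hs
  refine .of_bound (fun _ => norm_nonneg _) hs ⟨0, fun φ _ => ⟨φ.i ^ r, ?_⟩⟩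
  filter_upwards [eventually_pos] with ε e0
  have hi := φ.i_pos
  rw [φ.i_scale e0, Real.mul_rpow e0.le hi.le, RCLike.norm_ofReal, abs_of_nonneg (by positivity),
    mul_comm]

theorem sharpNorm_one [Nontrivial (GenNum 𝔽 F)] : sharpNorm (1 : GenNum 𝔽 F) = 1 := by
  refine le_antisymm ?_ ?_
  · simpa [alphaDot_zero] using sharpNorm_alphaDot_le (𝔽 := 𝔽) (F := F) 0
  · have h := sharpNorm_mul_le (1 : GenNum 𝔽 F) 1
    have h0 : 0 < sharpNorm (1 : GenNum 𝔽 F) :=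
      (sharpNorm_nonneg _).lt_of_ne fun h => one_ne_zero (eq_zero_of_sharpNorm_eq_zero h.symm)
    rw [mul_one] at h
    exact (le_mul_iff_one_le_left h0).1 h

theorem sharpNorm_alphaDot [Nontrivial (GenNum 𝔽 F)] (r : ℝ) :
    sharpNorm (alphaDot 𝔽 F r) = Real.exp (-r) := by
  refine (sharpNorm_alphaDot_le r).antisymm ?_
  have h := sharpNorm_mul_le (alphaDot 𝔽 F r) (alphaDot 𝔽 F (-r))
  rw [alphaDot_mul, add_neg_cancel, alphaDot_zero, sharpNorm_one] at h
  have h2 := h.trans (mul_le_mul_of_nonneg_left (sharpNorm_alphaDot_le (-r)) (sharpNorm_nonneg _))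
  rw [neg_neg] at h2
  rw [Real.exp_neg, inv_le_iff_one_le_mul₀ (Real.exp_pos r)]
  exact h2

theorem sharpNorm_mul_betaDot_inv_le (x : GenNum 𝔽 F) {s : ℝ} (hs : 0 < s) :
    sharpNorm (x * (((betaDot 𝔽 F s)⁻¹ : (GenNum 𝔽 F)ˣ) : GenNum 𝔽 F)) ≤ sharpNorm x / s := by
  refine (sharpNorm_mul_le _ _).trans ?_
  rw [div_eq_mul_inv]
  gcongr
  · exact sharpNorm_nonneg _
  · change sharpNorm (alphaDot 𝔽 F (Real.log s)) ≤ s⁻¹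
    refine (sharpNorm_alphaDot_le (Real.log s)).trans_eq ?_
    rw [Real.exp_neg, Real.exp_log hs]

theorem sharpNorm_pos {x : GenNum 𝔽 F} (hx : x ≠ 0) : 0 < sharpNorm x :=
  (sharpNorm_nonneg _).lt_of_ne fun h => hx (eq_zero_of_sharpNorm_eq_zero h.symm)

end Norm

section NormVec

variable {𝔽 : Type*} [RCLike 𝔽] {F : Type*} [RCLike F] {n : ℕ}

theorem sharpNorm_le_sharpNormVec (x : Fin n → GenNum 𝔽 F) (i : Fin n) :
    sharpNorm (x i) ≤ sharpNormVec x :=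
  le_ciSup (f := fun i => sharpNorm (x i)) (finite_range _).bddAbove i

theorem sharpNormVec_nonneg (x : Fin n → GenNum 𝔽 F) : 0 ≤ sharpNormVec x :=
  Real.iSup_nonneg fun _ => sharpNorm_nonneg _

theorem sharpNormVec_le {x : Fin n → GenNum 𝔽 F} {a : ℝ} (ha : 0 ≤ a)
    (h : ∀ i, sharpNorm (x i) ≤ a) : sharpNormVec x ≤ a := Real.iSup_le h ha

theorem sharpNormVec_pos {x : Fin n → GenNum 𝔽 F} (hx : x ≠ 0) : 0 < sharpNormVec x := by
  obtain ⟨i, hi⟩ := Function.ne_iff.1 hx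
  exact (sharpNorm_pos hi).trans_le (sharpNorm_le_sharpNormVec x i)

theorem sharpNormVec_single (i : Fin n) (h : GenNum 𝔽 F) :
    sharpNormVec (Pi.single i h) = sharpNorm h := by
  refine le_antisymm (sharpNormVec_le (sharpNorm_nonneg _) fun j => ?_) ?_
  · rcases eq_or_ne j i with rfl | hj
    · simp
    · simp [hj, sharpNorm_zero, sharpNorm_nonneg]
  · simpa using sharpNorm_le_sharpNormVec (Pi.single i h) i

theorem tendsto_sharpNormVec_sub (x₀ : Fin n → GenNum 𝔽 F) :
    Tendsto (fun x => sharpNormVec (x - x₀)) (𝓝 x₀) (𝓝 0) := by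
  have h : Tendsto (fun x : Fin n → GenNum 𝔽 F => ∑ i, sharpNorm (x i - x₀ i)) (𝓝 x₀)
      (𝓝 (∑ _i : Fin n, 0)) :=
    tendsto_finsetSum _ fun i _ => tendsto_nhds_iff_sharpNorm.1 ((continuous_apply i).tendsto x₀)
  rw [Finset.sum_const_zero] at h
  refine squeeze_zero (fun x => sharpNormVec_nonneg _) (fun x => ?_) h
  refine sharpNormVec_le (Finset.sum_nonneg fun i _ => sharpNorm_nonneg _) fun i => ?_
  exact Finset.single_le_sum (f := fun i => sharpNorm (x i - x₀ i))
    (fun i _ => sharpNorm_nonneg _) (Finset.mem_univ i)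

end NormVec

/-! ### Differential calculus -/

section Calculus

variable {𝔽 : Type*} [RCLike 𝔽] {𝕂 : Type*} [RCLike 𝕂] {n : ℕ} {U : Set (Fin n → GenNum 𝔽 ℝ)}

theorem tendsto_alphaDot_nhdsNE [Nontrivial (GenNum 𝔽 ℝ)] :
    Tendsto (fun k : ℕ => alphaDot 𝔽 ℝ (k : ℝ)) atTop (𝓝[≠] 0) := by
  refine tendsto_nhdsWithin_iff.2 ⟨tendsto_nhds_iff_sharpNorm.2 ?_, .of_forall fun k h => ?_⟩
  · simp only [sub_zero, sharpNorm_alphaDot]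
    exact Real.tendsto_exp_neg_atTop_nhds_zero.comp tendsto_natCast_atTop_atTop
  · have := sharpNorm_alphaDot (𝔽 := 𝔽) (F := ℝ) (k : ℝ)
    rw [mem_singleton_iff.1 h, sharpNorm_zero] at this
    exact (Real.exp_pos _).ne this

/-- The map `h ↦ x₀ + h e_i` is continuous. -/
theorem continuous_add_single (x₀ : Fin n → GenNum 𝔽 ℝ) (i : Fin n) :
    Continuous (fun h : GenNum 𝔽 ℝ => x₀ + Pi.single i h) :=
  continuous_const.add (continuous_single (A := fun _ : Fin n => GenNum 𝔽 ℝ) i)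

/-- Partial derivatives are unique: along `h = α̇_k`, `k → ∞`, the quotient `h / β̇_{‖h‖}` is `1`. -/
theorem HasSharpPartialAt.unique (hU : IsOpen U) {f : U → GenNum 𝔽 𝕂} {i : Fin n}
    {a b : GenNum 𝔽 𝕂} {x₀ : U} (ha : HasSharpPartialAt f i a x₀)
    (hb : HasSharpPartialAt f i b x₀) : a = b := by
  by_contra hab
  -- two different derivatives make both rings nontrivial, so that `‖α̇_k‖ = e^{-k}`
  have : Nontrivial (GenNum 𝔽 𝕂) := ⟨a, b, hab⟩
  have : Nontrivial (GenNum 𝔽 ℝ) := (GenNum.ofReal (𝔽 := 𝔽) (F := 𝕂)).domain_nontrivial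
  have hsub := hb.sub ha
  rw [sub_zero, tendsto_nhds_iff_sharpNorm] at hsub
  have hev := hsub.eventually_lt_const (sharpNorm_pos (sub_ne_zero.2 hab))
  rw [eventually_comap] at hev
  have hmem : ∀ᶠ h in 𝓝[≠] (0 : GenNum 𝔽 ℝ), x₀.1 + Pi.single i h ∈ U := by
    refine ((continuous_add_single x₀.1 i).continuousAt.eventually_mem ?_).filter_mono
      nhdsWithin_le_nhds
    simpa using hU.mem_nhds x₀.2
  obtain ⟨k, hk, hkU⟩ := (tendsto_alphaDot_nhdsNE.eventually (hev.and hmem)).exists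
  have := hk ⟨_, hkU⟩ rfl
  refine this.ne ?_
  rw [sub_zero, ← sub_mul, sub_sub_sub_cancel_left, ← sub_mul, ofReal_alphaDot, sharpNorm_alphaDot]
  change sharpNorm ((a - b) * alphaDot 𝔽 𝕂 k * alphaDot 𝔽 𝕂 (Real.log (Real.exp (-k)))) = _
  rw [Real.log_exp, mul_assoc, alphaDot_mul, add_neg_cancel, alphaDot_zero, mul_one]

theorem HasSharpPartialAt.sharpPartial_eq (hU : IsOpen U) {f : U → GenNum 𝔽 𝕂} {i : Fin n}
    {a : GenNum 𝔽 𝕂} {x₀ : U} (ha : HasSharpPartialAt f i a x₀) : sharpPartial f i x₀ = a := by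
  have h : ∃ a, HasSharpPartialAt f i a x₀ := ⟨a, ha⟩
  rw [sharpPartial, dif_pos h]
  exact h.choose_spec.unique hU ha

/-- The map `h ↦ x₀ + h e_i` into `U` sends punctured neighbourhoods of `0` to punctured
neighbourhoods of `x₀`. -/
theorem tendsto_add_single (x₀ : U) (i : Fin n) :
    Tendsto (fun h : {h : GenNum 𝔽 ℝ // x₀.1 + Pi.single i h ∈ U} =>
      (⟨x₀.1 + Pi.single i h.1, h.2⟩ : U)) (comap Subtype.val (𝓝[≠] 0)) (𝓝[≠] x₀) := by
  refine tendsto_nhdsWithin_iff.2 ⟨tendsto_subtype_rng.2 ?_, ?_⟩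
  · have := (continuous_add_single x₀.1 i).tendsto 0
    rw [Pi.single_zero, add_zero] at this
    exact (this.mono_left nhdsWithin_le_nhds).comp tendsto_comap
  · filter_upwards [preimage_mem_comap self_mem_nhdsWithin] with h hh heq
    refine hh ?_
    have h1 : x₀.1 + Pi.single i h.1 = x₀.1 := congrArg Subtype.val (mem_singleton_iff.1 heq)
    have h2 := congrFun (add_eq_left.1 h1) i
    simpa using h2

theorem HasSharpDerivAt.hasSharpPartialAt {f : U → GenNum 𝔽 𝕂} {a : Fin n → GenNum 𝔽 𝕂} {x₀ : U}
    (h : HasSharpDerivAt f a x₀) (i : Fin n) : HasSharpPartialAt f i (a i) x₀ := by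
  refine (h.comp (tendsto_add_single x₀ i)).congr fun k => ?_
  have h1 : ∀ j, (x₀.1 + Pi.single i k.1 : Fin n → GenNum 𝔽 ℝ) j - x₀.1 j = Pi.single (M := fun _ => GenNum 𝔽 ℝ) i k.1 j :=
    fun j => by simp
  have h2 : ∑ j, a j * GenNum.ofReal (Pi.single (M := fun _ => GenNum 𝔽 ℝ) i k.1 j) =
      a i * GenNum.ofReal k.1 := by
    rw [Finset.sum_eq_single i (fun j _ hj => by simp [hj]) (by simp), Pi.single_eq_same]
  simp only [Function.comp_apply, h1, h2, add_sub_cancel_left, sharpNormVec_single]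

theorem hasSharpPartialAt_const (c : GenNum 𝔽 𝕂) (i : Fin n) (x₀ : U) :
    HasSharpPartialAt (fun _ : U => c) i 0 x₀ := by
  simpa [HasSharpPartialAt] using tendsto_const_nhds

theorem HasSharpPartialAt.add {f g : U → GenNum 𝔽 𝕂} {i : Fin n} {a b : GenNum 𝔽 𝕂} {x₀ : U}
    (hf : HasSharpPartialAt f i a x₀) (hg : HasSharpPartialAt g i b x₀) :
    HasSharpPartialAt (f + g) i (a + b) x₀ := by
  have h := Tendsto.add hf hg
  rw [add_zero] at h
  refine h.congr fun k => ?_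
  simp only [Pi.add_apply]
  ring

/-- The product rule. -/
theorem HasSharpPartialAt.mul {f g : U → GenNum 𝔽 𝕂} {i : Fin n} {a b : GenNum 𝔽 𝕂} {x₀ : U}
    (hf : HasSharpPartialAt f i a x₀) (hg : HasSharpPartialAt g i b x₀) (hc : ContinuousAt g x₀) :
    HasSharpPartialAt (f * g) i (a * g x₀ + f x₀ * b) x₀ := by
  have hg' := (hc.tendsto.mono_left nhdsWithin_le_nhds).comp (tendsto_add_single x₀ i)
  -- `h / β̇_{‖h‖}` is bounded, so that its product with the increment of `g` tends to zero
  have hd : Tendsto (fun h : {h : GenNum 𝔽 ℝ // x₀.1 + Pi.single i h ∈ U} =>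
      (g ⟨x₀.1 + Pi.single i h.1, h.2⟩ - g x₀) *
        (GenNum.ofReal h.1 *
          (((betaDot 𝔽 𝕂 (sharpNorm h.1))⁻¹ : (GenNum 𝔽 𝕂)ˣ) : GenNum 𝔽 𝕂)))
      (comap Subtype.val (𝓝[≠] 0)) (𝓝 0) := by
    rw [tendsto_nhds_iff_sharpNorm]
    refine squeeze_zero' (.of_forall fun _ => sharpNorm_nonneg _) ?_ (tendsto_nhds_iff_sharpNorm.1 hg')
    filter_upwards [preimage_mem_comap self_mem_nhdsWithin] with h hh
    have hpos : 0 < sharpNorm h.1 := sharpNorm_pos hh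
    rw [sub_zero]
    refine (sharpNorm_mul_le _ _).trans (mul_le_of_le_one_right (sharpNorm_nonneg _) ?_)
    refine (sharpNorm_mul_betaDot_inv_le _ hpos).trans ?_
    rw [div_le_one hpos]
    exact sharpNorm_ofReal_le _
  have h := ((Tendsto.mul hf hg').add (hd.const_mul a)).add (Tendsto.const_mul (f x₀) hg)
  simp only [zero_mul, mul_zero, add_zero] at h
  refine h.congr fun k => ?_
  simp only [Pi.mul_apply, Function.comp_apply]
  ring

theorem mem_sharpC1_of_hasSharpPartialAt (hU : IsOpen U) {f : U → GenNum 𝔽 𝕂}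
    {f' : Fin n → U → GenNum 𝔽 𝕂} (hf : Continuous f) (hf' : ∀ i, Continuous (f' i))
    (h : ∀ i x₀, HasSharpPartialAt f i (f' i x₀) x₀) : f ∈ SharpC1 𝕂 U := by
  refine ⟨hf, fun i => ⟨fun x₀ => ⟨_, h i x₀⟩, ?_⟩⟩
  rw [show sharpPartial f i = f' i from funext fun x₀ => (h i x₀).sharpPartial_eq hU]
  exact hf' i

theorem hasSharpPartialAt_of_mem_sharpC1 {f : U → GenNum 𝔽 𝕂} (hf : f ∈ SharpC1 𝕂 U) (i : Fin n)
    (x₀ : U) : HasSharpPartialAt f i (sharpPartial f i x₀) x₀ := by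
  have h := (hf.2 i).1 x₀
  rw [sharpPartial, dif_pos h]
  exact h.choose_spec

/-- The algebra `𝒞¹(U; 𝕂̄)` with the pointwise operations. -/
noncomputable def sharpC1Subalgebra (hU : IsOpen U) :
    Subalgebra (GenNum 𝔽 𝕂) (U → GenNum 𝔽 𝕂) where
  carrier := SharpC1 𝕂 U
  mul_mem' := fun hf hg => mem_sharpC1_of_hasSharpPartialAt hU (hf.1.mul hg.1)
    (fun i => ((hf.2 i).2.mul hg.1).add (hf.1.mul (hg.2 i).2))
    fun i x₀ => (hasSharpPartialAt_of_mem_sharpC1 hf i x₀).mul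
      (hasSharpPartialAt_of_mem_sharpC1 hg i x₀) hg.1.continuousAt
  add_mem' := fun hf hg => mem_sharpC1_of_hasSharpPartialAt hU (hf.1.add hg.1)
    (fun i => (hf.2 i).2.add (hg.2 i).2)
    fun i x₀ => (hasSharpPartialAt_of_mem_sharpC1 hf i x₀).add
      (hasSharpPartialAt_of_mem_sharpC1 hg i x₀)
  algebraMap_mem' := fun c => mem_sharpC1_of_hasSharpPartialAt (f' := fun _ _ => 0) hU
    continuous_const (fun _ => continuous_const) fun i x₀ => hasSharpPartialAt_const c i x₀

/-- A remainder of second order in `‖x - x₀‖` gives differentiability. -/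
theorem HasSharpDerivAt.of_sq_bound {f : U → GenNum 𝔽 𝕂} {a : Fin n → GenNum 𝔽 𝕂} {x₀ : U} {C : ℝ}
    (h : ∀ x : U, sharpNormVec (x.1 - x₀.1) < 1 →
      sharpNorm (f x - f x₀ - ∑ i, a i * GenNum.ofReal (x.1 i - x₀.1 i)) ≤
        C * sharpNormVec (x.1 - x₀.1) ^ 2) : HasSharpDerivAt f a x₀ := by
  have ht : Tendsto (fun x : U => sharpNormVec (x.1 - x₀.1)) (𝓝[≠] x₀) (𝓝 0) :=
    ((tendsto_sharpNormVec_sub x₀.1).comp (continuous_subtype_val.tendsto x₀)).mono_left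
      nhdsWithin_le_nhds
  have htC := ht.const_mul C
  rw [mul_zero] at htC
  refine tendsto_nhds_iff_sharpNorm.2
    (squeeze_zero' (.of_forall fun _ => sharpNorm_nonneg _) ?_ htC)
  filter_upwards [ht.eventually_lt_const one_pos, self_mem_nhdsWithin] with x hx hne
  have hpos : 0 < sharpNormVec (x.1 - x₀.1) :=
    sharpNormVec_pos (sub_ne_zero.2 fun he => hne (Subtype.ext he))
  rw [sub_zero]
  refine (sharpNorm_mul_betaDot_inv_le _ hpos).trans ?_
  rw [div_le_iff₀ hpos]
  exact (h x hx).trans_eq (by ring)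

end Calculus

/-! ### Taylor's formula and comparison of nets -/

section Tools

variable {𝔽 : Type*} [RCLike 𝔽] {ι : Type*}

theorem eventually_nhdsGT_iff {P : ℝ → Prop} : (∀ᶠ ε : ℝ in 𝓝[>] 0, P ε) ↔
    ∃ η : ℝ, 0 < η ∧ η ≤ 1 ∧ ∀ ε : ℝ, 0 < ε → ε < η → P ε := by
  constructor
  · intro h
    obtain ⟨η, h0, H⟩ := mem_nhdsGT_iff_exists_Ioo_subset.1 h
    exact ⟨min η 1, lt_min h0 one_pos, min_le_right _ _,
      fun ε e0 e1 => H ⟨e0, e1.trans_le (min_le_left _ _)⟩⟩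
  · rintro ⟨η, h0, -, H⟩
    filter_upwards [eventually_pos, eventually_lt h0] with ε e0 e1 using H ε e0 e1

theorem DecaysAt.of_le_rpow_mul {v w : TestFn 𝔽 → ℝ} {r : ℝ} (hw : DecaysAt w r)
    (hv : ∀ φ, 0 ≤ v φ) (s : ℝ) (h : ∃ p : ℕ, ∀ φ ∈ A 𝔽 p, ∃ c : ℝ,
      ∀ᶠ ε : ℝ in 𝓝[>] 0, v (φ.scale ε) ≤ c * ε ^ s * w (φ.scale ε)) : DecaysAt v (r + s) := by
  obtain ⟨p, hp⟩ := hw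
  obtain ⟨q, hq⟩ := h
  refine ⟨p + q, fun φ hφ => ?_⟩
  obtain ⟨c, hc⟩ := hq φ (A_anti 𝔽 (by omega) hφ)
  have ht := (hp φ (A_anti 𝔽 (by omega) hφ)).const_mul c
  rw [mul_zero] at ht
  refine tendsto_of_tendsto_of_tendsto_of_le_of_le' tendsto_const_nhds ht ?_ ?_
  · filter_upwards [eventually_pos] with ε e0
    exact mul_nonneg (Real.rpow_nonneg e0.le _) (hv _)
  · filter_upwards [eventually_pos, hc] with ε e0 e1
    refine (mul_le_mul_of_nonneg_left e1 (Real.rpow_nonneg e0.le _)).trans_eq ?_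
    have : ε ^ (-(r + s)) * ε ^ s = ε ^ (-r) := by rw [← Real.rpow_add e0]; congr 1; ring
    rw [← this]
    ring

/-- Taylor's formula with a remainder of second order, for vector-valued functions. -/
theorem norm_sub_sub_fderiv_le {E G : Type*} [NormedAddCommGroup E] [NormedSpace ℝ E]
    [NormedAddCommGroup G] [NormedSpace ℝ G] {f : E → G} {x y : E} {C : ℝ}
    (hf : ∀ z ∈ Metric.closedBall x ‖y - x‖, ContDiffAt ℝ 2 f z)
    (hC : ∀ z ∈ Metric.closedBall x ‖y - x‖, ‖fderiv ℝ (fderiv ℝ f) z‖ ≤ C) :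
    ‖f y - f x - fderiv ℝ f x (y - x)‖ ≤ C * ‖y - x‖ ^ 2 := by
  have hx : x ∈ Metric.closedBall x ‖y - x‖ := Metric.mem_closedBall_self (norm_nonneg _)
  have hy : y ∈ Metric.closedBall x ‖y - x‖ := by rw [mem_closedBall_iff_norm]
  have hC0 : 0 ≤ C := (norm_nonneg (fderiv ℝ (fderiv ℝ f) x)).trans (hC x hx)
  have h1 : ∀ z ∈ Metric.closedBall x ‖y - x‖, ‖fderiv ℝ f z - fderiv ℝ f x‖ ≤ C * ‖y - x‖ := by
    intro z hz
    refine ((convex_closedBall x _).norm_image_sub_le_of_norm_fderiv_le (𝕜 := ℝ) (fun w hw =>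
      ((hf w hw).fderiv_right (m := 1) (by norm_num)).differentiableAt (by simp)) hC hx hz).trans ?_
    gcongr
    exact mem_closedBall_iff_norm.1 hz
  refine ((convex_closedBall x _).norm_image_sub_le_of_norm_fderiv_le' (𝕜 := ℝ)
    (fun w hw => (hf w hw).differentiableAt (by simp)) h1 hx hy).trans_eq ?_
  ring

end Tools

/-! ### Compactly supported points -/

section Points

variable {𝔽 : Type*} [RCLike 𝔽] {𝕂 : Type*} [RCLike 𝕂] {n : ℕ}
  {Ω : TopologicalSpace.Opens (Fin n → ℝ)}

/-- The distance `φ ↦ |y_φ - x_φ|` (in the maximum norm) of two nets of points. -/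
def netDist (x y : Fin n → ModNum 𝔽 ℝ) (φ : TestFn 𝔽) : ℝ :=
  ‖(fun i => (y i).1 φ) - (fun i => (x i).1 φ)‖

theorem decaysAt_netDist {x y : Fin n → ModNum 𝔽 ℝ} {r : ℝ}
    (h : sharpNormVec ((fun i => GenNum.mk (y i)) - fun i => GenNum.mk (x i)) < Real.exp (-r)) :
    DecaysAt (netDist x y) r := by
  have h1 : ∀ i, DecaysAt (fun φ => ‖(y i).1 φ - (x i).1 φ‖) r := fun i => by
    have := (sharpNorm_le_sharpNormVec _ i).trans_lt h
    rw [Pi.sub_apply, ← map_sub] at this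
    exact decaysAt_of_sharpNorm_mk_lt this
  refine (DecaysAt.sum Finset.univ fun i _ => h1 i).of_le (fun φ => norm_nonneg _)
    ⟨0, fun φ _ => .of_forall fun ε => ?_⟩
  refine (pi_norm_le_iff_of_nonneg (Finset.sum_nonneg fun i _ => norm_nonneg _)).2 fun i => ?_
  exact Finset.single_le_sum (f := fun i => ‖(y i).1 (φ.scale ε) - (x i).1 (φ.scale ε)‖)
    (fun i _ => norm_nonneg _) (Finset.mem_univ i)

theorem tendsto_netDist {x y : Fin n → ModNum 𝔽 ℝ}
    (h : sharpNormVec ((fun i => GenNum.mk (y i)) - fun i => GenNum.mk (x i)) < 1) :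
    ∃ p : ℕ, ∀ φ ∈ A 𝔽 p, Tendsto (fun ε : ℝ => netDist x y (φ.scale ε)) (𝓝[>] 0) (𝓝 0) := by
  obtain ⟨p, hp⟩ := decaysAt_netDist (r := 0) (by simpa using h)
  exact ⟨p, fun φ hφ => by simpa using hp φ hφ⟩

/-- A compactly supported net stays in a compact set together with balls of a fixed radius. -/
theorem IsCompactNet.exists_closedBall_subset {x : Fin n → ModNum 𝔽 ℝ} (hx : IsCompactNet Ω x) :
    ∃ W : Set (Fin n → ℝ), IsCompact W ∧ W ⊆ Ω ∧ ∃ δ > 0, ∃ p : ℕ, ∀ φ ∈ A 𝔽 p,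
      ∀ᶠ ε : ℝ in 𝓝[>] 0, Metric.closedBall (fun i => (x i).1 (φ.scale ε)) δ ⊆ W := by
  obtain ⟨-, K, hK, hKΩ, p, hp⟩ := hx
  obtain ⟨δ, hδ, hδW⟩ := hK.exists_cthickening_subset_open Ω.2 hKΩ
  refine ⟨Metric.cthickening δ K, hK.cthickening, hδW, δ, hδ, p, fun φ hφ => ?_⟩
  filter_upwards [eventually_nhdsGT_iff.2 (hp φ hφ)] with ε hε
  exact Metric.closedBall_subset_cthickening hε δ

/-- A net of points close to a compactly supported one can be changed, by redefining it where it
leaves `Ω`, to an equivalent compactly supported net. -/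
theorem IsCompactNet.exists_of_close {x y : Fin n → ModNum 𝔽 ℝ} (hx : IsCompactNet Ω x)
    (h : sharpNormVec ((fun i => GenNum.mk (y i)) - fun i => GenNum.mk (x i)) < 1) :
    ∃ z : Fin n → ModNum 𝔽 ℝ, (∀ i, GenNum.mk (z i) = GenNum.mk (y i)) ∧ IsCompactNet Ω z := by
  classical
  obtain ⟨W, hW, hWΩ, δ, hδ, p, hp⟩ := hx.exists_closedBall_subset
  obtain ⟨q, hq⟩ := tendsto_netDist h
  have hyW : ∀ φ ∈ A 𝔽 (p + q), ∀ᶠ ε : ℝ in 𝓝[>] 0, (fun i => (y i).1 (φ.scale ε)) ∈ W := by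
    intro φ hφ
    filter_upwards [hp φ (A_anti 𝔽 (by omega) hφ),
      (hq φ (A_anti 𝔽 (by omega) hφ)).eventually_le_const hδ] with ε h1 h2
    exact h1 (mem_closedBall_iff_norm.2 h2)
  let z' : Fin n → TestFn 𝔽 → ℝ := fun i φ =>
    if (fun i => (y i).1 φ) ∈ Ω then (y i).1 φ else (x i).1 φ
  have hz' : ∀ i, z' i ∈ ModNum 𝔽 ℝ := fun i => by
    change ModOn (univ : Set Unit) fun φ _ => ‖z' i φ‖
    refine (ModOn.add (v := fun φ (_ : Unit) => ‖(x i).1 φ‖) (w := fun φ _ => ‖(y i).1 φ‖)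
      (x i).2 (y i).2).mono fun φ _ _ => ?_
    have h1 := norm_nonneg ((x i).1 φ)
    have h2 := norm_nonneg ((y i).1 φ)
    simp only [z']
    split_ifs <;> linarith
  have hzy : ∀ φ, (fun i => (y i).1 φ) ∈ Ω → ∀ i, z' i φ = (y i).1 φ := fun φ hφ i => if_pos hφ
  refine ⟨fun i => ⟨z' i, hz' i⟩, fun i => GenNum.mk_eq_mk.2 ?_, fun φ => ?_, W, hW, hWΩ, p + q,
    fun φ hφ => eventually_nhdsGT_iff.1 ?_⟩
  · refine ⟨p + q, _, Gam_id, fun r hr φ hφ => ?_⟩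
    obtain ⟨η, h0, h1, H⟩ := eventually_nhdsGT_iff.1 (hyW φ (A_anti 𝔽 hr hφ))
    refine ⟨1, one_pos, η, h0, h1, fun ε e0 e1 _ _ => ?_⟩
    change ‖z' i (φ.scale ε) - (y i).1 (φ.scale ε)‖ ≤ _
    rw [hzy _ (hWΩ (H ε e0 e1)), sub_self, norm_zero]
    positivity
  · by_cases hφ : (fun i => (y i).1 φ) ∈ Ω
    · change (fun i => z' i φ) ∈ Ω
      rwa [funext (hzy φ hφ)]
    · change (fun i => z' i φ) ∈ Ω
      rw [show (fun i => z' i φ) = fun i => (x i).1 φ from funext fun i => if_neg hφ]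
      exact hx.1 φ
  · filter_upwards [hyW φ hφ] with ε hε
    rwa [funext (hzy _ (hWΩ hε))]

theorem isOpen_compactPoints (Ω : TopologicalSpace.Opens (Fin n → ℝ)) :
    IsOpen (CompactPoints 𝔽 Ω) := by
  refine isOpen_iff_mem_nhds.2 fun X hX => ?_
  obtain ⟨x, hxX, hx⟩ := hX
  filter_upwards [(tendsto_sharpNormVec_sub X).eventually_lt_const one_pos] with Y hY
  choose y hy using fun i => GenNum.mk_surjective (Y i)
  obtain ⟨z, hz, hzc⟩ := hx.exists_of_close (y := y) (by
    rwa [show (fun i => GenNum.mk (y i)) = Y from funext hy,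
      show (fun i => GenNum.mk (x i)) = X from funext hxX])
  exact ⟨z, fun i => (hz i).trans (hy i), hzc⟩

/-! ### The map `κ` -/

/-- Mean value and Taylor estimates for a moderate net `u` along a compactly supported net `x`; the
exponent `M` depends on `u` and `x` only. -/
theorem ModFun.exists_taylor_bound (u : ModFun 𝔽 𝕂 Ω) {x : Fin n → ModNum 𝔽 ℝ}
    (hx : IsCompactNet Ω x) : ∃ M : ℝ, ∀ y : Fin n → ModNum 𝔽 ℝ,
      sharpNormVec ((fun i => GenNum.mk (y i)) - fun i => GenNum.mk (x i)) < 1 →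
      ∃ p : ℕ, ∀ φ ∈ A 𝔽 p, ∃ c : ℝ, ∀ᶠ ε : ℝ in 𝓝[>] 0,
        ∀ a b : Fin n → ℝ, a = (fun i => (x i).1 (φ.scale ε)) → b = (fun i => (y i).1 (φ.scale ε)) →
        ‖u.1 (φ.scale ε) b - u.1 (φ.scale ε) a‖ ≤ c * ε ^ (-M) * ‖b - a‖ ∧
        ‖u.1 (φ.scale ε) b - u.1 (φ.scale ε) a - fderiv ℝ (u.1 (φ.scale ε)) a (b - a)‖ ≤
          c * ε ^ (-M) * ‖b - a‖ ^ 2 := by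
  obtain ⟨W, hW, hWΩ, δ, hδ, p, hp⟩ := hx.exists_closedBall_subset
  obtain ⟨M, hM⟩ := (u.2.2 W hW hWΩ 1).add (u.2.2 W hW hWΩ 2)
  refine ⟨M, fun y hy => ?_⟩
  obtain ⟨q, hq⟩ := tendsto_netDist hy
  refine ⟨p + q + M, fun φ hφ => ?_⟩
  obtain ⟨c, -, hc⟩ := hM φ (A_anti 𝔽 (by omega) hφ)
  refine ⟨c, ?_⟩
  filter_upwards [hp φ (A_anti 𝔽 (by omega) hφ), eventually_nhdsGT_iff.2 hc,
    (hq φ (A_anti 𝔽 (by omega) hφ)).eventually_le_const hδ] with ε h1 h2 h3 a b ha hb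
  subst ha hb
  set a : Fin n → ℝ := fun i => (x i).1 (φ.scale ε)
  set b : Fin n → ℝ := fun i => (y i).1 (φ.scale ε)
  have hball : Metric.closedBall a ‖b - a‖ ⊆ W :=
    (Metric.closedBall_subset_closedBall h3).trans h1
  have hcd : ∀ z ∈ Metric.closedBall a ‖b - a‖, ContDiffAt ℝ ∞ (u.1 (φ.scale ε)) z :=
    fun z hz => (u.2.1 _).contDiffAt (Ω.2.mem_nhds (hWΩ (hball hz)))
  constructor
  · refine (convex_closedBall a ‖b - a‖).norm_image_sub_le_of_norm_fderiv_le (𝕜 := ℝ)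
      (fun z hz => (hcd z hz).differentiableAt (by simp)) (fun z hz => ?_)
      (Metric.mem_closedBall_self (norm_nonneg _)) (mem_closedBall_iff_norm.2 le_rfl)
    rw [← norm_iteratedFDeriv_one]
    exact (le_add_of_nonneg_right (norm_nonneg _)).trans (h2 z (hball hz))
  · refine norm_sub_sub_fderiv_le (fun z hz => (hcd z hz)
      |>.of_le (WithTop.coe_le_coe.2 le_top))
      fun z hz => ?_
    rw [← norm_iteratedFDeriv_one, norm_iteratedFDeriv_fderiv]
    exact (le_add_of_nonneg_left (norm_nonneg _)).trans (h2 z (hball hz))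

/-- Mean value and Taylor estimates for `κ(f)` near a point `X`. -/
theorem exists_kappa_bound (f : GenFun 𝔽 𝕂 Ω) (X : CompactPoints 𝔽 Ω) :
    ∃ C : ℝ, ∀ Y : CompactPoints 𝔽 Ω, sharpNormVec (Y.1 - X.1) < 1 →
      sharpNorm (kappa f Y - kappa f X) ≤ C * sharpNormVec (Y.1 - X.1) ∧
      sharpNorm (kappa f Y - kappa f X -
        ∑ i, kappa (GenFun.partialDeriv i f) X * GenNum.ofReal (Y.1 i - X.1 i)) ≤
          C * sharpNormVec (Y.1 - X.1) ^ 2 := by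
  obtain ⟨u, rfl⟩ : ∃ u, GenFun.mk 𝔽 𝕂 Ω u = f := Ideal.Quotient.mk_surjective f
  obtain ⟨X, x, hxX, hx⟩ := X
  obtain ⟨M, hM⟩ := ModFun.exists_taylor_bound u hx
  refine ⟨Real.exp M, ?_⟩
  rintro ⟨Y, y, hyY, hy⟩ hYX
  obtain rfl : (fun i => GenNum.mk (x i)) = X := funext hxX
  obtain rfl : (fun i => GenNum.mk (y i)) = Y := funext hyY
  obtain ⟨p, hp⟩ := hM y hYX
  have hexp : ∀ r : ℝ, Real.exp (-(r + -M)) = Real.exp M * Real.exp (-r) := fun r => by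
    rw [← Real.exp_add]; congr 1; ring
  have hkX : ∀ v : ModFun 𝔽 𝕂 Ω, kappa (GenFun.mk 𝔽 𝕂 Ω v) ⟨_, x, hxX, hx⟩ =
      GenNum.mk (evalNet v x hx) := fun v => kappa_mk v _ x hxX hx
  have hkY : kappa (GenFun.mk 𝔽 𝕂 Ω u) ⟨_, y, hyY, hy⟩ = GenNum.mk (evalNet u y hy) :=
    kappa_mk u _ y hyY hy
  constructor
  · refine le_apply_of_forall_lt_exp (g := fun t => Real.exp M * t) (sharpNormVec_nonneg _)
      (by fun_prop) fun r hr => ?_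
    rw [hkX, hkY, ← map_sub]
    refine (sharpNorm_mk_le ((decaysAt_netDist hr).of_le_rpow_mul (fun _ => norm_nonneg _) (-M)
      ⟨p, fun φ hφ => ?_⟩)).trans_eq (hexp r)
    obtain ⟨c, hc⟩ := hp φ hφ
    exact ⟨c, hc.mono fun ε hε => (hε _ _ rfl rfl).1⟩
  · refine le_apply_of_forall_lt_exp (g := fun t => Real.exp M * t ^ 2) (sharpNormVec_nonneg _)
      (by fun_prop) fun r hr => ?_
    let R : ModNum 𝔽 𝕂 := evalNet u y hy - evalNet u x hx -
      ∑ i, evalNet (ModFun.partialDeriv i u) x hx * ⟨_, ofReal_mem_modNum (y i - x i)⟩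
    have hR : ∀ φ, R.1 φ = u.1 φ (fun i => (y i).1 φ) - u.1 φ (fun i => (x i).1 φ) -
        fderiv ℝ (u.1 φ) (fun i => (x i).1 φ)
          ((fun i => (y i).1 φ) - fun i => (x i).1 φ) := fun φ => by
      have h1 : R.1 φ = u.1 φ (fun i => (y i).1 φ) - u.1 φ (fun i => (x i).1 φ) -
          ∑ i, fderiv ℝ (u.1 φ) (fun i => (x i).1 φ) (Pi.single i 1) *
            ((((y i).1 φ - (x i).1 φ : ℝ)) : 𝕂) := by
        simp only [R, AddSubgroupClass.coe_sub, AddSubmonoidClass.coe_finsetSum, Pi.sub_apply,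
          Finset.sum_apply]
        rfl
      rw [h1]
      congr 1
      conv_rhs => rw [pi_eq_sum_univ' ((fun i => (y i).1 φ) - fun i => (x i).1 φ), map_sum]
      refine Finset.sum_congr rfl fun i _ => ?_
      rw [map_smul, RCLike.real_smul_eq_coe_mul, mul_comm]
      congr 3
    have hnum : kappa (GenFun.mk 𝔽 𝕂 Ω u) ⟨_, y, hyY, hy⟩ -
        kappa (GenFun.mk 𝔽 𝕂 Ω u) ⟨_, x, hxX, hx⟩ -
        ∑ i, kappa (GenFun.partialDeriv i (GenFun.mk 𝔽 𝕂 Ω u)) ⟨_, x, hxX, hx⟩ *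
          GenNum.ofReal (GenNum.mk (y i) - GenNum.mk (x i)) = GenNum.mk R := by
      rw [map_sub, map_sub, map_sum, hkX, hkY]
      congr 1
      refine Finset.sum_congr rfl fun i _ => ?_
      rw [map_mul, ← map_sub]
      exact congrArg (· * _) (hkX (ModFun.partialDeriv i u))
    refine (congrArg sharpNorm hnum).trans_le ?_
    have hsq : DecaysAt (fun φ => netDist x y φ ^ 2) (r + r) := by
      simpa only [pow_two] using (decaysAt_netDist hr).mul (decaysAt_netDist hr)
    have hRd : DecaysAt (fun φ => ‖R.1 φ‖) (r + r + -M) := by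
      refine hsq.of_le_rpow_mul (fun φ => norm_nonneg (R.1 φ)) (-M) ⟨p, fun φ hφ => ?_⟩
      obtain ⟨c, hc⟩ := hp φ hφ
      refine ⟨c, hc.mono fun ε hε => ?_⟩
      rw [hR]
      exact (hε _ _ rfl rfl).2
    refine (sharpNorm_mk_le hRd).trans_eq ?_
    rw [hexp, neg_add, Real.exp_add, pow_two]

theorem continuous_kappa_apply (f : GenFun 𝔽 𝕂 Ω) : Continuous (kappa f) := by
  refine continuous_iff_continuousAt.2 fun X => tendsto_nhds_iff_sharpNorm.2 ?_
  obtain ⟨C, hC⟩ := exists_kappa_bound f X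
  have ht : Tendsto (fun Y : CompactPoints 𝔽 Ω => sharpNormVec (Y.1 - X.1)) (𝓝 X) (𝓝 0) :=
    (tendsto_sharpNormVec_sub X.1).comp (continuous_subtype_val.tendsto X)
  have htC := ht.const_mul C
  rw [mul_zero] at htC
  refine squeeze_zero' (.of_forall fun _ => sharpNorm_nonneg _) ?_ htC
  filter_upwards [ht.eventually_lt_const one_pos] with Y hY using (hC Y hY).1

theorem hasSharpDerivAt_kappa (f : GenFun 𝔽 𝕂 Ω) (X : CompactPoints 𝔽 Ω) :
    HasSharpDerivAt (kappa f) (fun i => kappa (GenFun.partialDeriv i f) X) X :=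
  let ⟨_, hC⟩ := exists_kappa_bound f X
  .of_sq_bound fun Y hY => (hC Y hY).2

theorem hasSharpPartialAt_kappa (f : GenFun 𝔽 𝕂 Ω) (i : Fin n) (X : CompactPoints 𝔽 Ω) :
    HasSharpPartialAt (kappa f) i (kappa (GenFun.partialDeriv i f) X) X :=
  (hasSharpDerivAt_kappa f X).hasSharpPartialAt i

theorem kappa_mem_sharpC1 (f : GenFun 𝔽 𝕂 Ω) : kappa f ∈ SharpC1 𝕂 (CompactPoints 𝔽 Ω) :=
  mem_sharpC1_of_hasSharpPartialAt (isOpen_compactPoints Ω) (continuous_kappa_apply f)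
    (fun _ => continuous_kappa_apply _) (hasSharpPartialAt_kappa f)

variable (𝔽 𝕂 Ω) in
/-- The map `κ` as a homomorphism of algebras into the algebra of all functions on `Ω̃_c`. -/
noncomputable def kappaHom :
    GenFun 𝔽 𝕂 Ω →ₐ[GenNum 𝔽 𝕂] CompactPoints 𝔽 Ω → GenNum 𝔽 𝕂 where
  toFun := kappa
  map_one' := rfl
  map_zero' := rfl
  map_mul' f g := by
    obtain ⟨u, rfl⟩ := Ideal.Quotient.mk_surjective f
    obtain ⟨v, rfl⟩ := Ideal.Quotient.mk_surjective g
    rfl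
  map_add' f g := by
    obtain ⟨u, rfl⟩ := Ideal.Quotient.mk_surjective f
    obtain ⟨v, rfl⟩ := Ideal.Quotient.mk_surjective g
    rfl
  commutes' c := by
    obtain ⟨a, rfl⟩ := GenNum.mk_surjective c
    rfl

end Points

/-! ### Continuity of `κ` -/

section Continuity

variable {𝔽 : Type*} [RCLike 𝔽] {𝕂 : Type*} [RCLike 𝕂] {n : ℕ}
  {Ω : TopologicalSpace.Opens (Fin n → ℝ)}

theorem GenFun.seminorm_zero (K : Set (Fin n → ℝ)) (l : ℕ) :
    GenFun.seminorm K l (0 : GenFun 𝔽 𝕂 Ω) = 0 := by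
  refine le_antisymm (le_of_forall_lt_exp le_rfl fun r _ => ?_) ENNReal.toReal_nonneg
  refine toReal_exp_neg_sSup_le (r := r) ⟨0, map_zero _, 0, fun φ _ k _ => ?_⟩
  have h : ∀ (ψ : TestFn 𝔽) (x : Fin n → ℝ),
      iteratedFDeriv ℝ k ((0 : ModFun 𝔽 𝕂 Ω).1 ψ) x = 0 := fun ψ x => by
    change iteratedFDeriv ℝ k (fun _ => (0 : 𝕂)) x = 0
    rw [iteratedFDeriv_fun_zero]
    rfl
  simp only [h, norm_zero, mul_zero]
  exact tendsto_const_nhds.tendstoUniformlyOn_const K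

/-- The value at a point that stays in `K` is controlled by the seminorm of order `0` on `K`. -/
theorem sharpNorm_kappa_le {X : CompactPoints 𝔽 Ω} {x : Fin n → ModNum 𝔽 ℝ}
    (hxX : ∀ i, GenNum.mk (x i) = X.1 i) (hx : IsCompactNet Ω x) {K : Set (Fin n → ℝ)}
    (hK : IsCompact K) (hKΩ : K ⊆ Ω) {p : ℕ} (hp : ∀ φ ∈ A 𝔽 p, ∃ η : ℝ, 0 < η ∧ η ≤ 1 ∧
      ∀ ε : ℝ, 0 < ε → ε < η → (fun i => (x i).1 (φ.scale ε)) ∈ K) (f : GenFun 𝔽 𝕂 Ω) :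
    sharpNorm (kappa f X) ≤ GenFun.seminorm K 0 f := by
  refine le_of_forall_lt_exp ENNReal.toReal_nonneg fun r hr => ?_
  obtain ⟨s, ⟨u, rfl, q, hq⟩, hrs⟩ := exists_lt_of_toReal_exp_neg_sSup_lt (by
    -- moderate nets have finite order of vanishing
    obtain ⟨u, rfl⟩ : ∃ u, GenFun.mk 𝔽 𝕂 Ω u = f := Ideal.Quotient.mk_surjective f
    obtain ⟨N, hN⟩ := u.2.2 K hK hKΩ 0
    refine ⟨-(N + 1 : ℝ), u, rfl, N, fun φ hφ k hk => ?_⟩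
    obtain rfl : k = 0 := Nat.le_zero.1 hk
    obtain ⟨c, hc0, hc⟩ := hN φ hφ
    have hi := φ.i_pos
    have ht : Tendsto (fun ε : ℝ => φ.i ^ (N + 1 : ℝ) * c * ε) (𝓝[>] 0) (𝓝 0) := by
      simpa using (tendsto_rpow_nhdsGT_zero one_pos).const_mul (φ.i ^ (N + 1 : ℝ) * c)
    refine Metric.tendstoUniformlyOn_iff.2 fun δ hδ => ?_
    filter_upwards [eventually_pos, eventually_nhdsGT_iff.2 hc, ht.eventually_lt_const hδ]
      with ε e0 e1 e2 x hx
    have hiε : 0 ≤ (φ.scale ε).i := (φ.scale ε).i_pos.le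
    rw [dist_comm, Real.dist_0_eq_abs, abs_of_nonneg (by positivity), neg_neg]
    refine lt_of_le_of_lt ?_ e2
    calc _ ≤ (φ.scale ε).i ^ (N + 1 : ℝ) * (c * ε ^ (-(N : ℝ))) := by
          gcongr
          exact e1 x hx
      _ = _ := by
          have hε : ε ^ (N + 1 : ℝ) * ε ^ (-(N : ℝ)) = ε := by
            rw [← Real.rpow_add e0, add_neg_cancel_comm, Real.rpow_one]
          rw [φ.i_scale e0, Real.mul_rpow e0.le hi.le]
          calc _ = φ.i ^ (N + 1 : ℝ) * c * (ε ^ (N + 1 : ℝ) * ε ^ (-(N : ℝ))) := by ring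
            _ = _ := by rw [hε]) hr
  rw [kappa_mk u X x hxX hx]
  refine sharpNorm_mk_le (DecaysAt.anti (fun _ => norm_nonneg _) ?_ hrs.le)
  refine ⟨p + q, fun φ hφ => ?_⟩
  have h1 := hq φ (A_anti 𝔽 (by omega) hφ) 0 le_rfl
  have h2 := eventually_nhdsGT_iff.2 (hp φ (A_anti 𝔽 (by omega) hφ))
  have hi := φ.i_pos
  have h3 : Tendsto (fun ε : ℝ => (φ.scale ε).i ^ (-s) *
      ‖u.1 (φ.scale ε) (fun i => (x i).1 (φ.scale ε))‖) (𝓝[>] 0) (𝓝 0) := by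
    refine Metric.tendsto_nhds.2 fun δ hδ => ?_
    filter_upwards [Metric.tendstoUniformlyOn_iff.1 h1 δ hδ, h2] with ε e1 e2
    have := e1 _ e2
    rwa [dist_comm, norm_iteratedFDeriv_zero] at this
  have h4 := h3.const_mul (φ.i ^ s)
  rw [mul_zero] at h4
  refine h4.congr' ?_
  filter_upwards [eventually_pos] with ε e0
  rw [φ.i_scale e0, Real.mul_rpow e0.le hi.le]
  have : φ.i ^ s * φ.i ^ (-s) = 1 := by rw [← Real.rpow_add hi, add_neg_cancel, Real.rpow_zero]
  calc _ = φ.i ^ s * φ.i ^ (-s) * (ε ^ (-s) *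
      ‖u.1 (φ.scale ε) (fun i => (x i).1 (φ.scale ε))‖) := by ring
    _ = _ := by rw [this, one_mul]; rfl

theorem continuous_kappa (X : CompactPoints 𝔽 Ω) :
    Continuous (fun f : GenFun 𝔽 𝕂 Ω => kappa f X) := by
  obtain ⟨x, hxX, hx⟩ := X.2
  obtain ⟨-, K, hK, hKΩ, p, hp⟩ := id hx
  refine continuous_iff_continuousAt.2 fun f =>
    (nhds_hasBasis_sharpNorm _).tendsto_right_iff.2 fun ρ hρ => ?_
  have hopen : IsOpen {g : GenFun 𝔽 𝕂 Ω | GenFun.seminorm K 0 (g - f) < ρ} :=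
    TopologicalSpace.isOpen_generateFrom_of_mem ⟨K, 0, f, ρ, hK, hKΩ, hρ, rfl⟩
  filter_upwards [hopen.mem_nhds (by simpa [GenFun.seminorm_zero] using hρ)] with g hg
  have h := sharpNorm_kappa_le hxX hx hK hKΩ hp (g - f)
  rw [show kappa (g - f) X = kappa g X - kappa f X from
    congrFun (map_sub (kappaHom 𝔽 𝕂 Ω) g f) X] at h
  exact h.trans_lt hg

end Continuity

/-! ### Injectivity of `κ` -/

section Injectivity

variable {𝔽 : Type*} [RCLike 𝔽] {𝕂 : Type*} [RCLike 𝕂] {n : ℕ}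
  {Ω : TopologicalSpace.Opens (Fin n → ℝ)}

set_option maxSynthPendingDepth 4 in
theorem norm_fderiv_fderiv_iteratedFDeriv {E G : Type*} [NormedAddCommGroup E] [NormedSpace ℝ E]
    [NormedAddCommGroup G] [NormedSpace ℝ G] (f : E → G) (k : ℕ) (x : E) :
    ‖fderiv ℝ (fderiv ℝ (iteratedFDeriv ℝ k f)) x‖ = ‖iteratedFDeriv ℝ (k + 2) f x‖ := by
  rw [← norm_iteratedFDeriv_one, fderiv_iteratedFDeriv,
    LinearIsometryEquiv.norm_iteratedFDeriv_comp_left, norm_iteratedFDeriv_one,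
    norm_fderiv_iteratedFDeriv]

theorem Gam_half {γ : ℕ → ℝ} (h : γ ∈ Gam) : (fun q => γ q / 2) ∈ Gam :=
  ⟨fun q => by have := h.1 q; positivity, fun a b hab => by
    have := h.2.1 hab
    change γ a / 2 < γ b / 2
    linarith, h.2.2.atTop_div_const two_pos⟩

/-- Landau's inequality: the first derivative is bounded in terms of the function and of its second
derivative on a ball of radius `t`. -/
theorem norm_fderiv_le_of_bounds {E G : Type*} [NormedAddCommGroup E] [NormedSpace ℝ E]
    [NormedAddCommGroup G] [NormedSpace ℝ G] {g : E → G} {x : E} {t B D : ℝ} (ht : 0 < t)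
    (hg : ∀ z ∈ Metric.closedBall x t, ContDiffAt ℝ 2 g z)
    (hB : ∀ z ∈ Metric.closedBall x t, ‖g z‖ ≤ B)
    (hD : ∀ z ∈ Metric.closedBall x t, ‖fderiv ℝ (fderiv ℝ g) z‖ ≤ D) :
    ‖fderiv ℝ g x‖ ≤ 2 * B / t + D * t := by
  have hx : x ∈ Metric.closedBall x t := Metric.mem_closedBall_self ht.le
  have hB0 : 0 ≤ B := (norm_nonneg _).trans (hB x hx)
  have hD0 : 0 ≤ D := (norm_nonneg (fderiv ℝ (fderiv ℝ g) x)).trans (hD x hx)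
  refine ContinuousLinearMap.opNorm_le_of_unit_norm (by positivity) fun v hv => ?_
  have hn : ‖x + t • v - x‖ = t := by
    rw [add_sub_cancel_left, norm_smul, hv, mul_one, Real.norm_of_nonneg ht.le]
  have hT := norm_sub_sub_fderiv_le (f := g) (x := x) (y := x + t • v) (C := D)
    (by rwa [hn]) (by rwa [hn])
  rw [hn, add_sub_cancel_left, map_smul] at hT
  have h1 := hB _ (mem_closedBall_iff_norm.2 hn.le)
  have h2 := hB _ hx
  have h3 : ‖t • fderiv ℝ g x v‖ ≤ ‖g (x + t • v) - g x‖ +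
      ‖g (x + t • v) - g x - t • fderiv ℝ g x v‖ := by
    have := norm_sub_le (g (x + t • v) - g x) (g (x + t • v) - g x - t • fderiv ℝ g x v)
    rwa [sub_sub_cancel] at this
  have h4 := norm_sub_le (g (x + t • v)) (g x)
  rw [norm_smul, Real.norm_of_nonneg ht.le] at h3
  rw [show 2 * B / t + D * t = (2 * B + D * t ^ 2) / t by field_simp, le_div_iff₀ ht, mul_comm]
  linarith

/-- A moderate net is negligible as soon as its values are, without condition on the derivatives:
Landau's inequality with `t` proportional to `ε^{γ(q)/2}` passes from one order of differentiation
to the next, at the cost of halving `γ`. -/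
theorem mem_nullFun_of_nullOn (u : ModFun 𝔽 𝕂 Ω) (h : ∀ K : Set (Fin n → ℝ), IsCompact K → K ⊆ Ω →
    NullOn K (fun φ x => ‖u.1 φ x‖)) : u ∈ NullFun 𝔽 𝕂 Ω := by
  suffices H : ∀ k : ℕ, ∀ K : Set (Fin n → ℝ), IsCompact K → K ⊆ Ω →
      NullOn K (fun φ x => ‖iteratedFDeriv ℝ k (u.1 φ) x‖) from fun K hK hKΩ k => H k K hK hKΩ
  intro k
  induction k with
  | zero => simpa only [norm_iteratedFDeriv_zero] using h
  | succ k ih =>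
    intro K hK hKΩ
    obtain ⟨δ, hδ, hδΩ⟩ := hK.exists_cthickening_subset_open Ω.2 hKΩ
    obtain ⟨N, γ, hγ, hN⟩ := ih _ hK.cthickening hδΩ
    obtain ⟨M, hM⟩ := u.2.2 _ hK.cthickening hδΩ (k + 2)
    refine ⟨N + M, _, Gam_half hγ, fun q hq φ hφ => ?_⟩
    obtain ⟨c, hc, η, h0, h1, H⟩ := hN q (by omega) φ hφ
    obtain ⟨d, hd, θ, k0, -, J⟩ := hM φ (A_anti 𝔽 (by omega) hφ)
    refine ⟨2 * c / δ + d * δ, by positivity, min η θ, lt_min h0 k0, (min_le_left _ _).trans h1,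
      fun ε e0 e1 x hx => ?_⟩
    have eη : ε < η := e1.trans_le (min_le_left _ _)
    have eθ : ε < θ := e1.trans_le (min_le_right _ _)
    have e2 : ε ≤ 1 := (eη.trans_le h1).le
    have hγ0 := hγ.1 q
    have ht : 0 < δ * ε ^ (γ q / 2) := by positivity
    have htδ : δ * ε ^ (γ q / 2) ≤ δ :=
      mul_le_of_le_one_right hδ.le (Real.rpow_le_one e0.le e2 (by positivity))
    have hball : Metric.closedBall x (δ * ε ^ (γ q / 2)) ⊆ Metric.cthickening δ K :=
      (Metric.closedBall_subset_closedBall htδ).trans (Metric.closedBall_subset_cthickening hx δ)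
    have hL := norm_fderiv_le_of_bounds (g := iteratedFDeriv ℝ k (u.1 (φ.scale ε))) ht
      (fun z hz => ((u.2.1 _).contDiffAt (Ω.2.mem_nhds (hδΩ (hball hz)))).iteratedFDeriv_right
        (m := 2) (i := k) (by
          rw [show (2 : WithTop ℕ∞) + k = (((2 + k : ℕ) : ℕ∞) : WithTop ℕ∞) by push_cast; rfl]
          exact WithTop.coe_le_coe.2 le_top))
      (fun z hz => H ε e0 eη z (hball hz))
      (fun z hz => (norm_fderiv_fderiv_iteratedFDeriv _ _ _).trans_le (J ε e0 eθ z (hball hz)))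
    rw [norm_fderiv_iteratedFDeriv] at hL
    refine hL.trans ?_
    have a1 : ε ^ (γ q - (N : ℝ)) / ε ^ (γ q / 2) ≤ ε ^ (γ q / 2 - ((N + M : ℕ) : ℝ)) := by
      rw [← Real.rpow_sub e0]
      refine Real.rpow_le_rpow_of_exponent_ge e0 e2 ?_
      push_cast
      linarith [(Nat.cast_nonneg M : (0 : ℝ) ≤ M)]
    have a2 : ε ^ (-(M : ℝ)) * ε ^ (γ q / 2) ≤ ε ^ (γ q / 2 - ((N + M : ℕ) : ℝ)) := by
      rw [← Real.rpow_add e0]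
      refine Real.rpow_le_rpow_of_exponent_ge e0 e2 ?_
      push_cast
      linarith [(Nat.cast_nonneg N : (0 : ℝ) ≤ N)]
    calc _ = 2 * c / δ * (ε ^ (γ q - (N : ℝ)) / ε ^ (γ q / 2)) +
          d * δ * (ε ^ (-(M : ℝ)) * ε ^ (γ q / 2)) := by
          field_simp
      _ ≤ 2 * c / δ * ε ^ (γ q / 2 - ((N + M : ℕ) : ℝ)) +
          d * δ * ε ^ (γ q / 2 - ((N + M : ℕ) : ℝ)) := by gcongr
      _ = _ := by ring

/-- A generalized function all of whose point values vanish is zero: on a compact set `K`, test it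
at a net of points where `|u_φ|` attains its maximum over `K`. -/
theorem eq_zero_of_kappa_eq_zero {f : GenFun 𝔽 𝕂 Ω} (hf : kappa f = 0) : f = 0 := by
  obtain ⟨u, rfl⟩ := Ideal.Quotient.mk_surjective f
  refine Ideal.Quotient.eq_zero_iff_mem.2 (mem_nullFun_of_nullOn u fun K hK hKΩ => ?_)
  rcases K.eq_empty_or_nonempty with rfl | hne
  · exact NullOn.zero.mono fun φ x hx => hx.elim
  have hmax : ∀ φ : TestFn 𝔽, ∃ x ∈ K, IsMaxOn (fun x => ‖u.1 φ x‖) K x := fun φ =>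
    hK.exists_isMaxOn hne ((u.2.1 φ).continuousOn.mono hKΩ).norm
  choose x hxK hx using hmax
  obtain ⟨R, hR⟩ := hK.isBounded.exists_norm_le
  have hxm : ∀ i, (fun φ => x φ i) ∈ ModNum 𝔽 ℝ := fun i =>
    ModOn.mono (v := fun φ (_ : Unit) => ‖x φ i‖) (ModOn.const (S := univ) R) fun φ _ _ => by
      exact (norm_le_pi_norm (x φ) i).trans (hR _ (hxK φ))
  let y : Fin n → ModNum 𝔽 ℝ := fun i => ⟨_, hxm i⟩
  have hy : IsCompactNet Ω y := ⟨fun φ => hKΩ (hxK φ), K, hK, hKΩ, 0,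
    fun φ _ => ⟨1, one_pos, le_rfl, fun ε _ _ => hxK _⟩⟩
  have h0 : GenNum.mk (evalNet u y hy) = GenNum.mk 0 := by
    rw [map_zero]
    exact (kappa_mk u ⟨_, y, fun _ => rfl, hy⟩ y (fun _ => rfl) hy).symm.trans (congrFun hf _)
  obtain ⟨N, γ, hγ, hN⟩ := GenNum.mk_eq_mk.1 h0
  refine ⟨N, γ, hγ, fun q hq φ hφ => ?_⟩
  obtain ⟨c, hc, η, h0, h1, H⟩ := hN q hq φ hφ
  refine ⟨c, hc, η, h0, h1, fun ε e0 e1 z hz => ?_⟩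
  have h2 : ‖u.1 (φ.scale ε) z‖ ≤ ‖u.1 (φ.scale ε) (x (φ.scale ε))‖ := hx _ hz
  have h3 : ‖u.1 (φ.scale ε) (x (φ.scale ε)) - 0‖ ≤ _ := H ε e0 e1 () trivial
  rw [sub_zero] at h3
  exact h2.trans h3

end Injectivity

end Colombeau

theorem mainTheorem1 {𝔽 : Type*} [RCLike 𝔽] {𝕂 : Type*} [RCLike 𝕂] {n : ℕ}
    (Ω : TopologicalSpace.Opens (Fin n → ℝ)) :
    IsOpen (CompactPoints 𝔽 Ω) ∧
    ∃ (C : Subalgebra (GenNum 𝔽 𝕂) (CompactPoints 𝔽 Ω → GenNum 𝔽 𝕂))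
      (Φ : GenFun 𝔽 𝕂 Ω →ₐ[GenNum 𝔽 𝕂] C),
      (C : Set (CompactPoints 𝔽 Ω → GenNum 𝔽 𝕂)) = SharpC1 𝕂 (CompactPoints 𝔽 Ω) ∧
      (∀ f : GenFun 𝔽 𝕂 Ω, (Φ f : CompactPoints 𝔽 Ω → GenNum 𝔽 𝕂) = kappa f) ∧
      Function.Injective Φ ∧
      Continuous Φ ∧
      (∀ (f : GenFun 𝔽 𝕂 Ω) (X : CompactPoints 𝔽 Ω),
        HasSharpDerivAt (kappa f) (fun i => kappa (GenFun.partialDeriv i f) X) X) ∧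
      ∀ (f : GenFun 𝔽 𝕂 Ω) (i : Fin n),
        kappa (GenFun.partialDeriv i f) = sharpPartial (kappa f) i := by
  have hopen : IsOpen (CompactPoints 𝔽 Ω) := isOpen_compactPoints Ω
  refine ⟨hopen, sharpC1Subalgebra hopen,
    (kappaHom 𝔽 𝕂 Ω).codRestrict (sharpC1Subalgebra hopen) kappa_mem_sharpC1, rfl, fun _ => rfl,
    (injective_iff_map_eq_zero _).2 fun f hf => eq_zero_of_kappa_eq_zero (congrArg Subtype.val hf),
    continuous_induced_rng.2 (continuous_pi continuous_kappa), hasSharpDerivAt_kappa, fun f i => ?_⟩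
  funext X
  exact ((hasSharpPartialAt_kappa f i X).sharpPartial_eq hopen).symm
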